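/- **Theorem 2.3.** Let $n\ge 1$, let $(\Omega_i,S_i,\mu_i)$, $i=1,\dots,n$, be $\sigma$-finite measure spaces, let $\Omega=\Omega_1\times\cdots\times\Omega_n$ carry the product measure $\mu=\mu_1\otimes\cdots\otimes\mu_n$, and let $P=(p_1,\dots,p_n)$ with $1\le p_i<\infty$ for all $i$. Let $w:\Omega\to(0,\infty)$ be a strictly positive measurable function such that $$w(x_1,\dots,x_n)\le w_1(x_1)\cdots w_n(x_n)\qquad\text{for all }(x_1,\dots,x_n)\in\Omega$$ for some strictly positive measurable functions $w_i:\Omega_i\to(0,\infty)$. Let $L^P_w=L^{(p_1,\dots,p_n)}_w$ be the space of ($\mu$-almost everywhere equivalence classes of) real- or complex-valued measurable functions $f$ on $\Omega$ with $$\|f\|_{L^P_w}=\left(\int_{\Omega_n}\cdots\left(\int_{\Omega_2}\left(\int_{\Omega_1}|f(x)|^{p_1}\,w(x)\,d\mu_1(x_1)\right)^{\frac{p_2}{p_1}}d\mu_2(x_2)\right)^{\frac{p_3}{p_2}}\cdots\, d\mu_n(x_n)\right)^{\frac1{p_n}}<\infty .$$ Then $L^P_w$ has the metric approximation property: for every compact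 set $K\subset L^P_w$ and every $\varepsilon>0$ there is a bounded linear operator $F:L^P_w\to L^P_w$ of finite rank with $\|F\|\le 1$ and $$\|f-Ff\|_{L^P_w}<\varepsilon\qquad\text{for all } f\in K .$$ -/

import Mathlib

open MeasureTheory
open scoped ENNReal

universe u

noncomputable section

namespace MixedNorm

section Integrals

/-- The iterated part of a mixed norm. Given `h` of `n` remaining variables and the previous
exponent `q`, one forms successively, for `k = 1, …, n` (the first variable being the innermost),
`∫ (⋯)^(p_k / p_{k-1}) dμ_k` with `p_0 = q`, and at the end takes the power `1 / p_n`. -/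
def iter : {n : ℕ} → {Ω : Fin n → Type u} → [∀ i, MeasurableSpace (Ω i)] →
    (μ : ∀ i, Measure (Ω i)) → (p : Fin n → ℝ) → (q : ℝ) → (h : (∀ i, Ω i) → ℝ≥0∞) → ℝ≥0∞
  | 0, _, _, _, _, q, h => h (fun i => i.elim0) ^ (1 / q)
  | _ + 1, _, _, μ, p, q, h =>
      iter (fun i => μ i.succ) (fun i => p i.succ) (p 0)
        (fun y => ∫⁻ x, h (Fin.cons x y) ^ (p 0 / q) ∂(μ 0))

/-- The mixed norm, with values in `[0, ∞]`,
`(∫ ⋯ (∫ (∫ |f|^{p₁} w dμ₁(x₁))^{p₂/p₁} dμ₂(x₂))^{p₃/p₂} ⋯ dμ_N(x_N))^{1/p_N}`, `N = n + 1`,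
of a function `f` of `N` variables. -/
def mixedENorm {n : ℕ} {Ω : Fin (n + 1) → Type u} [∀ i, MeasurableSpace (Ω i)] {𝕜 : Type*} [RCLike 𝕜]
    (μ : ∀ i, Measure (Ω i)) (p : Fin (n + 1) → ℝ) (w : (∀ i, Ω i) → ℝ)
    (f : (∀ i, Ω i) → 𝕜) : ℝ≥0∞ :=
  iter (fun i => μ i.succ) (fun i => p i.succ) (p 0)
    (fun y => ∫⁻ x, ‖f (Fin.cons x y)‖ₑ ^ p 0 * ENNReal.ofReal (w (Fin.cons x y)) ∂(μ 0))

/-- Auxiliary: the unweighted mixed norm written as an iteration of `L^{p_i}` norms. -/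
def lpIter : {n : ℕ} → {Ω : Fin n → Type u} → [∀ i, MeasurableSpace (Ω i)] →
    (μ : ∀ i, Measure (Ω i)) → (p : Fin n → ℝ) → (h : (∀ i, Ω i) → ℝ≥0∞) → ℝ≥0∞
  | 0, _, _, _, _, h => h (fun i => i.elim0)
  | _ + 1, _, _, μ, p, h =>
      lpIter (fun i => μ i.succ) (fun i => p i.succ)
        (fun y => (∫⁻ x, h (Fin.cons x y) ^ p 0 ∂(μ 0)) ^ (1 / p 0))

theorem iter_eq_lpIter {n : ℕ} {Ω : Fin n → Type u} [∀ i, MeasurableSpace (Ω i)]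
    (μ : ∀ i, Measure (Ω i)) (p : Fin n → ℝ) (hp : ∀ i, 1 ≤ p i) (q : ℝ)
    (h : (∀ i, Ω i) → ℝ≥0∞) :
    iter μ p q h = lpIter μ p (fun x => h x ^ (1 / q)) := by
  induction n generalizing q with
  | zero => rfl
  | succ n ih =>
    rw [iter, lpIter, ih _ _ (fun i => hp i.succ)]
    congr 1
    funext y
    simp only [← ENNReal.rpow_mul, div_eq_mul_inv, mul_comm (p 0), one_mul]

theorem mixedENorm_eq_lpIter {n : ℕ} {Ω : Fin (n + 1) → Type u} [∀ i, MeasurableSpace (Ω i)]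
    {𝕜 : Type*} [RCLike 𝕜] (μ : ∀ i, Measure (Ω i)) (p : Fin (n + 1) → ℝ) (hp : ∀ i, 1 ≤ p i)
    (w : (∀ i, Ω i) → ℝ) (f : (∀ i, Ω i) → 𝕜) :
    mixedENorm μ p w f = lpIter μ p (fun x => ‖f x‖ₑ * ENNReal.ofReal (w x) ^ (1 / p 0)) := by
  have h0 : 0 < p 0 := lt_of_lt_of_le one_pos (hp 0)
  rw [mixedENorm, lpIter, iter_eq_lpIter _ _ (fun i => hp i.succ)]
  congr 1
  funext y
  simp only [ENNReal.mul_rpow_of_nonneg _ _ h0.le, ← ENNReal.rpow_mul, one_div,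
    inv_mul_cancel₀ h0.ne', ENNReal.rpow_one]

theorem lpIter_mono {n : ℕ} {Ω : Fin n → Type u} [∀ i, MeasurableSpace (Ω i)]
    (μ : ∀ i, Measure (Ω i)) (p : Fin n → ℝ) (hp : ∀ i, 1 ≤ p i)
    {g h : (∀ i, Ω i) → ℝ≥0∞} (hgh : ∀ x, g x ≤ h x) : lpIter μ p g ≤ lpIter μ p h := by
  induction n with
  | zero => exact hgh _
  | succ n ih =>
    have h0 : 0 < p 0 := lt_of_lt_of_le one_pos (hp 0)
    refine ih _ _ (fun i => hp i.succ) fun y => ?_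
    have := hgh
    gcongr
    exact hgh _

theorem cons_eq {n : ℕ} {Ω : Fin (n + 1) → Type u} [∀ i, MeasurableSpace (Ω i)] :
    (fun z : Ω 0 × (∀ i : Fin n, Ω i.succ) => (Fin.cons z.1 z.2 : ∀ i, Ω i)) =
      (MeasurableEquiv.piFinSuccAbove Ω 0).symm := by
  funext z i
  refine Fin.cases ?_ (fun j => ?_) i
  · rfl
  · rfl

theorem measurable_cons {n : ℕ} {Ω : Fin (n + 1) → Type u} [∀ i, MeasurableSpace (Ω i)] :
    Measurable (fun z : Ω 0 × (∀ i : Fin n, Ω i.succ) => (Fin.cons z.1 z.2 : ∀ i, Ω i)) :=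
  cons_eq (Ω := Ω) ▸ (MeasurableEquiv.piFinSuccAbove Ω 0).symm.measurable

theorem measurePreserving_cons {n : ℕ} {Ω : Fin (n + 1) → Type u} [∀ i, MeasurableSpace (Ω i)]
    (μ : ∀ i, Measure (Ω i)) [∀ i, SigmaFinite (μ i)] :
    MeasurePreserving (fun z : Ω 0 × (∀ i : Fin n, Ω i.succ) => (Fin.cons z.1 z.2 : ∀ i, Ω i))
      ((μ 0).prod (Measure.pi fun i : Fin n => μ i.succ)) (Measure.pi μ) :=
  cons_eq (Ω := Ω) ▸ (measurePreserving_piFinSuccAbove μ 0).symm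

theorem ae_cons {n : ℕ} {Ω : Fin (n + 1) → Type u} [∀ i, MeasurableSpace (Ω i)]
    (μ : ∀ i, Measure (Ω i)) [∀ i, SigmaFinite (μ i)] {P : (∀ i, Ω i) → Prop}
    (h : ∀ᵐ x ∂(Measure.pi μ), P x) :
    ∀ᵐ y ∂(Measure.pi fun i : Fin n => μ i.succ), ∀ᵐ x ∂(μ 0), P (Fin.cons x y) := by
  have h1 := (measurePreserving_cons μ).quasiMeasurePreserving.ae h
  have h2 := (Measure.measurePreserving_swap (μ := Measure.pi fun i : Fin n => μ i.succ)
    (ν := μ 0)).quasiMeasurePreserving.ae h1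
  exact Measure.ae_ae_of_ae_prod h2

theorem measurable_step {n : ℕ} {Ω : Fin (n + 1) → Type u} [∀ i, MeasurableSpace (Ω i)]
    (μ : ∀ i, Measure (Ω i)) [∀ i, SigmaFinite (μ i)] (p : ℝ)
    {h : (∀ i, Ω i) → ℝ≥0∞} (hh : Measurable h) :
    Measurable (fun y : (∀ i : Fin n, Ω i.succ) =>
      (∫⁻ x, h (Fin.cons x y) ^ p ∂(μ 0)) ^ (1 / p)) := by
  refine Measurable.pow_const ?_ _
  exact Measurable.lintegral_prod_left (f := fun x (y : ∀ i : Fin n, Ω i.succ) =>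
    h (Fin.cons x y) ^ p) ((hh.comp measurable_cons).pow_const _)

theorem lpIter_congr_ae {n : ℕ} {Ω : Fin n → Type u} [∀ i, MeasurableSpace (Ω i)]
    (μ : ∀ i, Measure (Ω i)) [∀ i, SigmaFinite (μ i)] (p : Fin n → ℝ)
    {g h : (∀ i, Ω i) → ℝ≥0∞} (hgh : g =ᵐ[Measure.pi μ] h) :
    lpIter μ p g = lpIter μ p h := by
  induction n with
  | zero =>
    have : g (fun i => i.elim0) = h (fun i => i.elim0) := by
      have h1 : ∀ᵐ x ∂(Measure.pi μ), g x = h x := hgh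
      rw [Measure.pi_of_empty μ (fun i => i.elim0)] at h1
      by_contra hne
      have h2 := ae_iff.1 h1
      rw [Measure.dirac_apply_of_mem (by exact hne)] at h2
      exact one_ne_zero h2
    exact this
  | succ n ih =>
    refine ih _ _ ?_
    filter_upwards [ae_cons μ hgh] with y hy
    congr 1
    refine lintegral_congr_ae ?_
    filter_upwards [hy] with x hx
    rw [hx]

theorem lpIter_add_le_of_measurable {n : ℕ} {Ω : Fin n → Type u} [∀ i, MeasurableSpace (Ω i)]
    (μ : ∀ i, Measure (Ω i)) [∀ i, SigmaFinite (μ i)] (p : Fin n → ℝ) (hp : ∀ i, 1 ≤ p i)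
    {g h : (∀ i, Ω i) → ℝ≥0∞} (hg : Measurable g) (hh : Measurable h) :
    lpIter μ p (fun x => g x + h x) ≤ lpIter μ p g + lpIter μ p h := by
  induction n with
  | zero => exact le_rfl
  | succ n ih =>
    refine le_trans ?_ (ih _ _ (fun i => hp i.succ) (measurable_step μ (p 0) hg)
      (measurable_step μ (p 0) hh))
    refine lpIter_mono _ _ (fun i => hp i.succ) fun y => ?_
    have hc : Measurable (fun x : Ω 0 => (Fin.cons x y : ∀ i, Ω i)) :=
      measurable_cons.comp (measurable_id.prodMk measurable_const)
    exact ENNReal.lintegral_Lp_add_le (hg.comp hc).aemeasurable (hh.comp hc).aemeasurable (hp 0)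

theorem lpIter_add_le {n : ℕ} {Ω : Fin n → Type u} [∀ i, MeasurableSpace (Ω i)]
    (μ : ∀ i, Measure (Ω i)) [∀ i, SigmaFinite (μ i)] (p : Fin n → ℝ) (hp : ∀ i, 1 ≤ p i)
    {g h : (∀ i, Ω i) → ℝ≥0∞} (hg : AEMeasurable g (Measure.pi μ))
    (hh : AEMeasurable h (Measure.pi μ)) :
    lpIter μ p (fun x => g x + h x) ≤ lpIter μ p g + lpIter μ p h := by
  rw [lpIter_congr_ae μ p hg.ae_eq_mk, lpIter_congr_ae μ p hh.ae_eq_mk,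
    lpIter_congr_ae μ p (g := fun x => g x + h x)
      (h := fun x => hg.mk g x + hh.mk h x) (hg.ae_eq_mk.add hh.ae_eq_mk)]
  exact lpIter_add_le_of_measurable μ p hp hg.measurable_mk hh.measurable_mk

theorem lpIter_const_mul {n : ℕ} {Ω : Fin n → Type u} [∀ i, MeasurableSpace (Ω i)]
    (μ : ∀ i, Measure (Ω i)) (p : Fin n → ℝ) (hp : ∀ i, 1 ≤ p i)
    {c : ℝ≥0∞} (hc : c ≠ ∞) (h : (∀ i, Ω i) → ℝ≥0∞) :
    lpIter μ p (fun x => c * h x) = c * lpIter μ p h := by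
  induction n with
  | zero => rfl
  | succ n ih =>
    have h0 : 0 < p 0 := lt_of_lt_of_le one_pos (hp 0)
    rw [lpIter, lpIter, ← ih _ _ (fun i => hp i.succ)]
    congr 1
    funext y
    simp only [ENNReal.mul_rpow_of_nonneg _ _ h0.le]
    rw [lintegral_const_mul' _ _ (ENNReal.rpow_ne_top_of_nonneg h0.le hc),
      ENNReal.mul_rpow_of_nonneg _ _ (by positivity), ← ENNReal.rpow_mul,
      mul_one_div_cancel h0.ne', ENNReal.rpow_one]

theorem ae_eq_zero_of_lpIter_eq_zero {n : ℕ} {Ω : Fin n → Type u} [∀ i, MeasurableSpace (Ω i)]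
    (μ : ∀ i, Measure (Ω i)) [∀ i, SigmaFinite (μ i)] (p : Fin n → ℝ) (hp : ∀ i, 1 ≤ p i)
    {h : (∀ i, Ω i) → ℝ≥0∞} (hh : Measurable h) (hz : lpIter μ p h = 0) :
    ∀ᵐ x ∂(Measure.pi μ), h x = 0 := by
  induction n with
  | zero =>
    refine Filter.Eventually.of_forall fun x => ?_
    rw [Subsingleton.elim x (fun i => i.elim0)]
    exact hz
  | succ n ih =>
    have h0 : 0 < p 0 := lt_of_lt_of_le one_pos (hp 0)
    have h1 := ih _ _ (fun i => hp i.succ) (measurable_step μ (p 0) hh) hz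
    have hs : MeasurableSet {x : ∀ i, Ω i | h x = 0} := hh (measurableSet_singleton 0)
    rw [← (measurePreserving_cons μ).map_eq, ae_map_iff measurable_cons.aemeasurable hs,
      ← Measure.prod_swap]
    refine (ae_map_iff measurable_swap.aemeasurable (hs.preimage measurable_cons)).2 ?_
    refine (Measure.ae_prod_iff_ae_ae (hs.preimage (measurable_cons.comp measurable_swap))).2 ?_
    filter_upwards [h1] with y hy
    have hc : Measurable (fun x : Ω 0 => (Fin.cons x y : ∀ i, Ω i)) :=
      measurable_cons.comp (measurable_id.prodMk measurable_const)
    rw [ENNReal.rpow_eq_zero_iff_of_pos (by positivity)] at hy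
    have hy' := (lintegral_eq_zero_iff ((hh.comp hc).pow_const (p 0))).1 hy
    filter_upwards [hy'] with x hx
    exact (ENNReal.rpow_eq_zero_iff_of_pos h0).1 hx

end Integrals

/-- A strictly positive function on the product space, measurable with respect to the (completed)
product measure. -/
structure Weight {n : ℕ} {Ω : Fin n → Type u} [∀ i, MeasurableSpace (Ω i)]
    (μ : ∀ i, Measure (Ω i)) where
  toFun : (∀ i, Ω i) → ℝ
  pos : ∀ x, 0 < toFun x
  aemeasurable : AEMeasurable toFun (Measure.pi μ)

section Space

variable {n : ℕ} {Ω : Fin (n + 1) → Type u} [∀ i, MeasurableSpace (Ω i)]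
  {𝕜 : Type*} [RCLike 𝕜] {μ : ∀ i, Measure (Ω i)} {p : Fin (n + 1) → ℝ} {w : Weight μ}

theorem aemeasurable_integrand (w : Weight μ) (q : ℝ) {f : (∀ i, Ω i) → 𝕜}
    (hf : AEStronglyMeasurable f (Measure.pi μ)) :
    AEMeasurable (fun x => ‖f x‖ₑ * ENNReal.ofReal (w.toFun x) ^ q) (Measure.pi μ) :=
  hf.enorm.mul (w.aemeasurable.ennreal_ofReal.pow_const _)

theorem mixedENorm_smul (hp : ∀ i, 1 ≤ p i) (c : 𝕜) (f : (∀ i, Ω i) → 𝕜) :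
    mixedENorm μ p w.toFun (c • f) = ‖c‖ₑ * mixedENorm μ p w.toFun f := by
  rw [mixedENorm_eq_lpIter _ _ hp, mixedENorm_eq_lpIter _ _ hp, ← lpIter_const_mul μ p hp enorm_ne_top]
  congr 1
  funext x
  rw [Pi.smul_apply, smul_eq_mul, enorm_mul, mul_assoc]

theorem mixedENorm_zero (hp : ∀ i, 1 ≤ p i) :
    mixedENorm μ p w.toFun (0 : (∀ i, Ω i) → 𝕜) = 0 := by
  have := mixedENorm_smul (μ := μ) (w := w) hp (0 : 𝕜) (0 : (∀ i, Ω i) → 𝕜)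
  simpa using this

variable [∀ i, SigmaFinite (μ i)]

theorem mixedENorm_congr_ae (hp : ∀ i, 1 ≤ p i) {f g : (∀ i, Ω i) → 𝕜} (h : f =ᵐ[Measure.pi μ] g) :
    mixedENorm μ p w.toFun f = mixedENorm μ p w.toFun g := by
  rw [mixedENorm_eq_lpIter _ _ hp, mixedENorm_eq_lpIter _ _ hp]
  refine lpIter_congr_ae μ p ?_
  filter_upwards [h] with x hx
  rw [hx]

theorem mixedENorm_add_le (hp : ∀ i, 1 ≤ p i) {f g : (∀ i, Ω i) → 𝕜}
    (hf : AEStronglyMeasurable f (Measure.pi μ)) (hg : AEStronglyMeasurable g (Measure.pi μ)) :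
    mixedENorm μ p w.toFun (f + g) ≤ mixedENorm μ p w.toFun f + mixedENorm μ p w.toFun g := by
  rw [mixedENorm_eq_lpIter _ _ hp, mixedENorm_eq_lpIter _ _ hp, mixedENorm_eq_lpIter _ _ hp]
  refine le_trans (lpIter_mono μ p hp fun x => ?_) (lpIter_add_le μ p hp
    (aemeasurable_integrand w _ hf) (aemeasurable_integrand w _ hg))
  rw [← add_mul]
  gcongr
  exact enorm_add_le _ _

theorem ae_eq_zero_of_mixedENorm_eq_zero (hp : ∀ i, 1 ≤ p i) {f : (∀ i, Ω i) → 𝕜}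
    (hf : AEStronglyMeasurable f (Measure.pi μ)) (h : mixedENorm μ p w.toFun f = 0) :
    f =ᵐ[Measure.pi μ] 0 := by
  have h0 : 0 < p 0 := lt_of_lt_of_le one_pos (hp 0)
  have hm := aemeasurable_integrand w (1 / p 0) hf
  rw [mixedENorm_eq_lpIter _ _ hp, lpIter_congr_ae μ p hm.ae_eq_mk] at h
  filter_upwards [ae_eq_zero_of_lpIter_eq_zero μ p hp hm.measurable_mk h, hm.ae_eq_mk] with x h1 h2
  rw [h1, mul_eq_zero, ENNReal.rpow_eq_zero_iff_of_pos (by positivity),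
    ENNReal.ofReal_eq_zero] at h2
  rcases h2 with h2 | h2
  · simpa using h2
  · exact absurd (w.pos x) (not_lt.2 h2)

variable (𝕜 μ p w) in
/-- The weighted mixed-norm space `L_w^P(μ)`: classes modulo almost everywhere equality of
measurable functions on the product space whose mixed norm is finite. -/
def Space [Fact (∀ i, 1 ≤ p i)] : Submodule 𝕜 ((∀ i, Ω i) →ₘ[Measure.pi μ] 𝕜) where
  carrier := {f | mixedENorm μ p w.toFun f < ∞}
  zero_mem' := by
    have hp : ∀ i, 1 ≤ p i := Fact.out
    change mixedENorm μ p w.toFun (0 : (∀ i, Ω i) →ₘ[Measure.pi μ] 𝕜) < ∞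
    rw [mixedENorm_congr_ae hp AEEqFun.coeFn_zero, mixedENorm_zero hp]
    exact ENNReal.zero_lt_top
  add_mem' := by
    intro f g hf hg
    have hp : ∀ i, 1 ≤ p i := Fact.out
    change mixedENorm μ p w.toFun (f + g : (∀ i, Ω i) →ₘ[Measure.pi μ] 𝕜) < ∞
    rw [mixedENorm_congr_ae hp (AEEqFun.coeFn_add f g)]
    exact (mixedENorm_add_le hp f.aestronglyMeasurable g.aestronglyMeasurable).trans_lt
      (ENNReal.add_lt_top.2 ⟨hf, hg⟩)
  smul_mem' := by
    intro c f hf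
    have hp : ∀ i, 1 ≤ p i := Fact.out
    change mixedENorm μ p w.toFun (c • f : (∀ i, Ω i) →ₘ[Measure.pi μ] 𝕜) < ∞
    rw [mixedENorm_congr_ae hp (AEEqFun.coeFn_smul c f), mixedENorm_smul hp]
    exact ENNReal.mul_lt_top enorm_lt_top hf

variable [Fact (∀ i, 1 ≤ p i)]

instance : Norm (Space 𝕜 μ p w) where
  norm f := (mixedENorm μ p w.toFun (f : (∀ i, Ω i) →ₘ[Measure.pi μ] 𝕜)).toReal

theorem norm_def (f : Space 𝕜 μ p w) :
    ‖f‖ = (mixedENorm μ p w.toFun (f : (∀ i, Ω i) →ₘ[Measure.pi μ] 𝕜)).toReal := rfl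

theorem normCore : NormedSpace.Core 𝕜 (Space 𝕜 μ p w) where
  norm_nonneg f := ENNReal.toReal_nonneg
  norm_smul c f := by
    have hp : ∀ i, 1 ≤ p i := Fact.out
    rw [norm_def, norm_def, Submodule.coe_smul, mixedENorm_congr_ae hp (AEEqFun.coeFn_smul c _),
      mixedENorm_smul hp, ENNReal.toReal_mul, toReal_enorm]
  norm_triangle f g := by
    have hp : ∀ i, 1 ≤ p i := Fact.out
    have hf : mixedENorm μ p w.toFun (f : (∀ i, Ω i) →ₘ[Measure.pi μ] 𝕜) ≠ ∞ := f.2.ne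
    have hg : mixedENorm μ p w.toFun (g : (∀ i, Ω i) →ₘ[Measure.pi μ] 𝕜) ≠ ∞ := g.2.ne
    rw [norm_def, norm_def, norm_def, Submodule.coe_add, mixedENorm_congr_ae hp (AEEqFun.coeFn_add _ _),
      ← ENNReal.toReal_add hf hg]
    exact ENNReal.toReal_mono (ENNReal.add_ne_top.2 ⟨hf, hg⟩)
      (mixedENorm_add_le hp (AEEqFun.aestronglyMeasurable _) (AEEqFun.aestronglyMeasurable _))
  norm_eq_zero_iff f := by
    have hp : ∀ i, 1 ≤ p i := Fact.out
    constructor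
    · intro h
      have hz := (ENNReal.toReal_eq_zero_iff _).1 h
      rcases hz with hz | hz
      · have := ae_eq_zero_of_mixedENorm_eq_zero hp (AEEqFun.aestronglyMeasurable _) hz
        exact Subtype.ext (AEEqFun.ext (this.trans AEEqFun.coeFn_zero.symm))
      · exact absurd hz f.2.ne
    · rintro rfl
      rw [norm_def, Submodule.coe_zero, mixedENorm_congr_ae hp AEEqFun.coeFn_zero, mixedENorm_zero hp,
        ENNReal.toReal_zero]

instance : NormedAddCommGroup (Space 𝕜 μ p w) := NormedAddCommGroup.ofCore normCore

instance : NormedSpace 𝕜 (Space 𝕜 μ p w) := NormedSpace.ofCore normCore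

end Space

/-- The metric approximation property of a normed space `E`: the identity can be approximated
uniformly on compact sets by bounded operators of finite rank and norm at most one. -/
def MetricApproximationProperty (𝕜 E : Type*) [RCLike 𝕜] [NormedAddCommGroup E]
    [NormedSpace 𝕜 E] : Prop :=
  ∀ K : Set E, IsCompact K → ∀ ε : ℝ, 0 < ε →
    ∃ F : E →L[𝕜] E, FiniteDimensional 𝕜 (LinearMap.range (F : E →ₗ[𝕜] E)) ∧ ‖F‖ ≤ 1 ∧
      ∀ x ∈ K, ‖x - F x‖ < ε

end MixedNorm

end

/-! Multiplication by `w ^ (1 / p₁)` identifies the weighted space isometrically with the unweighted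
mixed-norm space (`unweight`), and there the approximating operators are conditional expectations:
take finitely many disjoint cells of finite measure in each factor and replace a function by its
average on every box of cells.

Such an operator has finite rank, and it contracts for every choice of exponents, because its kernel
is dominated by a product of one-variable kernels whose marginals are at most one. Variables are
peeled off one at a time: Minkowski's inequality moves the innermost norm past the integral over the
other variables, and the Schur test treats the innermost variable (`lpIter_lintegral_prod_mul_le`).

Let the cells be the atoms cut out by finite families of sets of finite measure, directed by
inclusion. Once the families contain the sides of a box, averaging fixes the indicator of that box
(`sum_setIntegral_indicator_ae_eq`). These indicators have dense span
(`topologicalClosure_span_boxes`), by a π-λ argument and dominated convergence in mixed norms.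
Contractions converging to the identity on a set of dense span converge to it everywhere, and
uniformly on compact sets. -/

open Filter Topology

noncomputable section

namespace MixedNorm

/-! ### Minkowski, Jensen and Schur inequalities for lower Lebesgue integrals. -/

section Inequalities

variable {α β : Type*} [MeasurableSpace α] [MeasurableSpace β]

/-- **Minkowski's integral inequality**, for an outer function whose `p`-th power is integrable and
which is dominated by the integral. -/
theorem rpow_lintegral_rpow_le_of_le_lintegral {μ : Measure α} {ν : Measure β} [SFinite μ]
    [SFinite ν] {p : ℝ} (hp : 1 < p) {f : α → β → ℝ≥0∞} (hf : Measurable (Function.uncurry f))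
    {g : α → ℝ≥0∞} (hg : Measurable g) (hgf : ∀ x, g x ≤ ∫⁻ y, f x y ∂ν)
    (hfin : ∫⁻ x, g x ^ p ∂μ ≠ ∞) :
    (∫⁻ x, g x ^ p ∂μ) ^ (1 / p) ≤ ∫⁻ y, (∫⁻ x, f x y ^ p ∂μ) ^ (1 / p) ∂ν := by
  have h0 : 0 < p := one_pos.trans hp
  have hpq := Real.HolderConjugate.conjExponent hp
  set q := Real.conjExponent p
  set I := ∫⁻ x, g x ^ p ∂μ with hI
  set R := ∫⁻ y, (∫⁻ x, f x y ^ p ∂μ) ^ (1 / p) ∂ν with hR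
  have hfx : ∀ x, Measurable (f x) := fun x => hf.comp measurable_prodMk_left
  have hfy : ∀ y, Measurable fun x => f x y := fun y => hf.comp measurable_prodMk_right
  -- The duality proof: in `g ^ p = g * g ^ (p - 1)` bound the first factor by the integral of `f`,
  -- swap, and apply Hölder, using `(p - 1) * q = p`.
  have key : I ≤ R * I ^ (1 / q) := by
    calc I = ∫⁻ x, g x * g x ^ (p - 1) ∂μ := by
          refine lintegral_congr fun x => ?_
          conv_rhs => rw [← ENNReal.rpow_one (g x), ← ENNReal.rpow_mul, one_mul]
          rw [← ENNReal.rpow_add_of_nonneg _ _ zero_le_one (by linarith)]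
          congr 1
          ring
      _ ≤ ∫⁻ x, (∫⁻ y, f x y ∂ν) * g x ^ (p - 1) ∂μ := by
          gcongr with x
          exact hgf x
      _ = ∫⁻ x, ∫⁻ y, f x y * g x ^ (p - 1) ∂ν ∂μ := by
          refine lintegral_congr fun x => ?_
          rw [lintegral_mul_const _ (hfx x)]
      _ = ∫⁻ y, ∫⁻ x, f x y * g x ^ (p - 1) ∂μ ∂ν := by
          refine lintegral_lintegral_swap (Measurable.aemeasurable ?_)
          exact hf.mul ((hg.comp measurable_fst).pow_const _)
      _ ≤ ∫⁻ y, (∫⁻ x, f x y ^ p ∂μ) ^ (1 / p) * I ^ (1 / q) ∂ν := by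
          gcongr with y
          have hq : ∀ x, (g x ^ (p - 1)) ^ q = g x ^ p := fun x => by
            rw [← ENNReal.rpow_mul, hpq.sub_one_mul_conj]
          refine (ENNReal.lintegral_mul_le_Lp_mul_Lq μ hpq (hfy y).aemeasurable
            (hg.pow_const (p - 1)).aemeasurable).trans_eq ?_
          simp only [hq, hI]
      _ = R * I ^ (1 / q) := by
          rw [lintegral_mul_const]
          exact (Measurable.lintegral_prod_left (f := fun x y => f x y ^ p)
            (hf.pow_const p)).pow_const _
  rcases eq_or_ne I 0 with hz | hz
  · rw [hz, ENNReal.zero_rpow_of_pos (by positivity)]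
    exact zero_le
  · have hq0 : 0 < 1 / q := one_div_pos.2 hpq.symm.pos
    have hne : I ^ (1 / q) ≠ 0 := by
      rw [Ne, ENNReal.rpow_eq_zero_iff_of_pos hq0]
      exact hz
    have htop : I ^ (1 / q) ≠ ∞ := ENNReal.rpow_ne_top_of_nonneg hq0.le hfin
    -- Cancelling `I ^ (1 / q)` is where finiteness of `I` is needed.
    refine (ENNReal.mul_le_mul_iff_left hne htop).1 ?_
    refine le_trans (le_of_eq ?_) key
    rw [← ENNReal.rpow_add_of_nonneg _ _ (by positivity) hq0.le, one_div, one_div,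
      hpq.inv_add_inv_eq_one, ENNReal.rpow_one]

/-- **Minkowski's integral inequality**. -/
theorem rpow_lintegral_rpow_lintegral_le (μ : Measure α) (ν : Measure β) [SigmaFinite μ]
    [SFinite ν] {p : ℝ} (hp : 1 ≤ p) {f : α → β → ℝ≥0∞} (hf : Measurable (Function.uncurry f)) :
    (∫⁻ x, (∫⁻ y, f x y ∂ν) ^ p ∂μ) ^ (1 / p) ≤ ∫⁻ y, (∫⁻ x, f x y ^ p ∂μ) ^ (1 / p) ∂ν := by
  -- For exponent one this is Tonelli's theorem.
  rcases hp.eq_or_lt with rfl | hp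
  · simp only [ENNReal.rpow_one, div_one]
    exact (lintegral_lintegral_swap hf.aemeasurable).le
  have h0 : 0 < p := one_pos.trans hp
  set G : α → ℝ≥0∞ := fun x => ∫⁻ y, f x y ∂ν
  have hG : Measurable G := hf.lintegral_prod_right
  -- Truncating `G` in height and in support makes the `p`-th power integrable; Fatou's lemma then
  -- removes the truncation.
  set g : ℕ → α → ℝ≥0∞ := fun k => (spanningSets μ k).indicator fun x => min (G x) k
  have hg : ∀ k, Measurable (g k) := fun k =>
    (hG.min measurable_const).indicator (measurableSet_spanningSets μ k)
  have hgG : ∀ k x, g k x ≤ G x := fun k x =>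
    (Set.indicator_le_self _ _ x).trans (min_le_left _ _)
  have hfin : ∀ k, ∫⁻ x, g k x ^ p ∂μ ≠ ∞ := fun k => by
    have hle : ∫⁻ x, g k x ^ p ∂μ ≤ ∫⁻ x, (spanningSets μ k).indicator (fun _ => (k : ℝ≥0∞) ^ p) x ∂μ := by
      refine lintegral_mono fun x => ?_
      by_cases hx : x ∈ spanningSets μ k
      · simp only [g, Set.indicator_of_mem hx]
        exact ENNReal.rpow_le_rpow (min_le_right _ _) h0.le
      · simp only [g, Set.indicator_of_notMem hx, ENNReal.zero_rpow_of_pos h0, le_refl]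
    refine (hle.trans_lt ?_).ne
    rw [lintegral_indicator_const (measurableSet_spanningSets μ k)]
    exact ENNReal.mul_lt_top (ENNReal.rpow_lt_top_of_nonneg h0.le (ENNReal.natCast_ne_top k))
      (measure_spanningSets_lt_top μ k)
  have hlim : ∀ x, Tendsto (fun k => g k x) atTop (𝓝 (G x)) := fun x => by
    have h1 : Tendsto (fun k : ℕ => min (G x) (k : ℝ≥0∞)) atTop (𝓝 (min (G x) ∞)) :=
      tendsto_const_nhds.min ENNReal.tendsto_nat_nhds_top
    rw [min_top_right] at h1
    refine h1.congr' ?_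
    filter_upwards [eventually_ge_atTop (spanningSetsIndex μ x)] with k hk
    have hx : x ∈ spanningSets μ k :=
      monotone_spanningSets μ hk (mem_spanningSetsIndex μ x)
    simp only [g, Set.indicator_of_mem hx]
  have hle : ∀ k, ∫⁻ x, g k x ^ p ∂μ ≤ (∫⁻ y, (∫⁻ x, f x y ^ p ∂μ) ^ (1 / p) ∂ν) ^ p := fun k => by
    rw [← ENNReal.rpow_inv_le_iff h0, ← one_div]
    exact rpow_lintegral_rpow_le_of_le_lintegral hp hf (hg k) (hgG k) (hfin k)
  have hfatou : ∫⁻ x, G x ^ p ∂μ ≤ (∫⁻ y, (∫⁻ x, f x y ^ p ∂μ) ^ (1 / p) ∂ν) ^ p := by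
    calc ∫⁻ x, G x ^ p ∂μ = ∫⁻ x, liminf (fun k => g k x ^ p) atTop ∂μ := by
          refine lintegral_congr fun x => ?_
          exact (((ENNReal.continuous_rpow_const).tendsto _).comp (hlim x)).liminf_eq.symm
      _ ≤ liminf (fun k => ∫⁻ x, g k x ^ p ∂μ) atTop :=
          lintegral_liminf_le fun k => (hg k).pow_const p
      _ ≤ _ := liminf_le_of_frequently_le' (Frequently.of_forall hle)
  rw [one_div, ENNReal.rpow_inv_le_iff h0]
  simpa only [one_div] using hfatou

/-- **Jensen's inequality** for the power function and a density of mass at most one. -/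
theorem rpow_lintegral_mul_le {μ : Measure α} {p : ℝ} (hp : 1 ≤ p) {k h : α → ℝ≥0∞}
    (hk : Measurable k) (hh : Measurable h) (hk1 : ∫⁻ x, k x ∂μ ≤ 1) :
    (∫⁻ x, k x * h x ∂μ) ^ p ≤ ∫⁻ x, k x * h x ^ p ∂μ := by
  rcases hp.eq_or_lt with rfl | hp
  · simp only [ENNReal.rpow_one, le_refl]
  have h0 : 0 < p := one_pos.trans hp
  have hpq := Real.HolderConjugate.conjExponent hp
  set q := Real.conjExponent p
  have hq0 : 0 < q := hpq.symm.pos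
  rw [← ENNReal.le_rpow_inv_iff h0]
  -- Hölder after splitting `k = k ^ (1 / p) * k ^ (1 / q)`; the second factor has `L^q` norm at
  -- most one.
  calc ∫⁻ x, k x * h x ∂μ = ∫⁻ x, (k x ^ (1 / p) * h x) * k x ^ (1 / q) ∂μ := by
        refine lintegral_congr fun x => ?_
        rw [mul_right_comm, ← ENNReal.rpow_add_of_nonneg _ _ (by positivity) (by positivity),
          one_div, one_div, hpq.inv_add_inv_eq_one, ENNReal.rpow_one]
    _ ≤ (∫⁻ x, (k x ^ (1 / p) * h x) ^ p ∂μ) ^ (1 / p) *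
          (∫⁻ x, (k x ^ (1 / q)) ^ q ∂μ) ^ (1 / q) :=
        ENNReal.lintegral_mul_le_Lp_mul_Lq μ hpq ((hk.pow_const _).mul hh).aemeasurable
          (hk.pow_const _).aemeasurable
    _ ≤ (∫⁻ x, (k x ^ (1 / p) * h x) ^ p ∂μ) ^ (1 / p) * 1 := by
        gcongr
        refine ENNReal.rpow_le_one ?_ (by positivity)
        simpa only [← ENNReal.rpow_mul, one_div_mul_cancel hq0.ne', ENNReal.rpow_one] using hk1
    _ = (∫⁻ x, k x * h x ^ p ∂μ) ^ p⁻¹ := by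
        simp only [mul_one, ENNReal.mul_rpow_of_nonneg _ _ h0.le, ← ENNReal.rpow_mul,
          one_div]
        simp only [inv_mul_cancel₀ h0.ne', ENNReal.rpow_one]

/-- The **Schur test**: a kernel both of whose marginals are at most one contracts `L^p`. -/
theorem lintegral_rpow_lintegral_mul_le {μ : Measure α} [SFinite μ] {p : ℝ} (hp : 1 ≤ p)
    {k : α → α → ℝ≥0∞} (hk : Measurable (Function.uncurry k)) (hk₁ : ∀ x, ∫⁻ y, k x y ∂μ ≤ 1)
    (hk₂ : ∀ y, ∫⁻ x, k x y ∂μ ≤ 1) {h : α → ℝ≥0∞} (hh : Measurable h) :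
    ∫⁻ x, (∫⁻ y, k x y * h y ∂μ) ^ p ∂μ ≤ ∫⁻ y, h y ^ p ∂μ := by
  -- Jensen uses the marginal in `y`; after Tonelli the marginal in `x` finishes.
  calc ∫⁻ x, (∫⁻ y, k x y * h y ∂μ) ^ p ∂μ ≤ ∫⁻ x, ∫⁻ y, k x y * h y ^ p ∂μ ∂μ :=
        lintegral_mono fun x =>
          rpow_lintegral_mul_le hp (hk.comp measurable_prodMk_left) hh (hk₁ x)
    _ = ∫⁻ y, ∫⁻ x, k x y * h y ^ p ∂μ ∂μ :=
        lintegral_lintegral_swap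
          (hk.mul ((hh.comp measurable_snd).pow_const _)).aemeasurable
    _ = ∫⁻ y, (∫⁻ x, k x y ∂μ) * h y ^ p ∂μ := by
        refine lintegral_congr fun y => ?_
        exact lintegral_mul_const _ (hk.comp measurable_prodMk_right)
    _ ≤ ∫⁻ y, 1 * h y ^ p ∂μ := by
        gcongr with y
        exact hk₂ y
    _ = ∫⁻ y, h y ^ p ∂μ := by simp only [one_mul]

end Inequalities

/-! ### Mixed norms of measurable functions, by induction on the number of variables. -/

section Iterated

variable {n : ℕ}

theorem lintegral_pi_succ {Ω : Fin (n + 1) → Type u} [∀ i, MeasurableSpace (Ω i)]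
    (μ : ∀ i, Measure (Ω i)) [∀ i, SigmaFinite (μ i)] {h : (∀ i, Ω i) → ℝ≥0∞} (hh : Measurable h) :
    ∫⁻ z, h z ∂(Measure.pi μ) =
      ∫⁻ y, ∫⁻ x, h (Fin.cons x y) ∂(μ 0) ∂(Measure.pi fun i : Fin n => μ i.succ) := by
  rw [← (measurePreserving_cons μ).lintegral_comp hh]
  exact lintegral_prod_symm _ (hh.comp measurable_cons).aemeasurable

/-- A product of kernels with marginals at most one contracts every mixed norm. -/
theorem lpIter_lintegral_prod_mul_le {Ω : Fin n → Type u} [∀ i, MeasurableSpace (Ω i)]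
    (μ : ∀ i, Measure (Ω i)) [∀ i, SigmaFinite (μ i)] (p : Fin n → ℝ) (hp : ∀ i, 1 ≤ p i)
    {k : ∀ i, Ω i → Ω i → ℝ≥0∞} (hk : ∀ i, Measurable (Function.uncurry (k i)))
    (hk₁ : ∀ i x, ∫⁻ y, k i x y ∂(μ i) ≤ 1) (hk₂ : ∀ i y, ∫⁻ x, k i x y ∂(μ i) ≤ 1)
    {h : (∀ i, Ω i) → ℝ≥0∞} (hh : Measurable h) :
    lpIter μ p (fun x => ∫⁻ y, (∏ i, k i (x i) (y i)) * h y ∂(Measure.pi μ)) ≤ lpIter μ p h := by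
  induction n with
  | zero =>
    rw [lpIter, lpIter, Measure.pi_of_empty μ (fun i => i.elim0), lintegral_dirac' _ (by fun_prop)]
    simp
  | succ n ih =>
    have h0 : 0 < p 0 := lt_of_lt_of_le one_pos (hp 0)
    have hkm : ∀ i {γ : Type u} [MeasurableSpace γ] {a b : γ → Ω i}, Measurable a → Measurable b →
        Measurable fun c => k i (a c) (b c) := fun i _ _ _ _ ha hb => (hk i).comp (ha.prodMk hb)
    -- The induction hypothesis is applied to the `L^{p 0}` norm of `h` in its first variable. What
    -- remains is an inequality for each fixed `y`.
    refine le_trans ?_ (ih (fun i => μ i.succ) (fun i => p i.succ) (fun i => hp i.succ)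
      (fun i => hk i.succ) (fun i => hk₁ i.succ) (fun i => hk₂ i.succ) (measurable_step μ (p 0) hh))
    rw [lpIter]
    refine lpIter_mono _ _ (fun i => hp i.succ) fun y => ?_
    have hhc : Measurable fun z : Ω 0 × (∀ i : Fin n, Ω i.succ) => h (Fin.cons z.1 z.2) :=
      hh.comp measurable_cons
    have hK : Measurable fun y' : ∀ i : Fin n, Ω i.succ => ∏ i, k i.succ (y i) (y' i) :=
      Finset.measurable_fun_prod _ fun i _ => hkm _ measurable_const (measurable_pi_apply i)
    have hA : Measurable fun z : Ω 0 × (∀ i : Fin n, Ω i.succ) =>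
        ∫⁻ x', k 0 z.1 x' * h (Fin.cons x' z.2) ∂(μ 0) := by
      refine Measurable.lintegral_prod_right (f := fun (z : Ω 0 × (∀ i : Fin n, Ω i.succ)) x' =>
        k 0 z.1 x' * h (Fin.cons x' z.2)) ?_
      refine (hkm 0 (measurable_fst.comp measurable_fst) measurable_snd).mul ?_
      exact hhc.comp (measurable_snd.prodMk (measurable_snd.comp measurable_fst))
    have hstep : ∀ x, ∫⁻ z, (∏ i, k i ((Fin.cons x y : ∀ i, Ω i) i) (z i)) * h z ∂(Measure.pi μ) =
        ∫⁻ y', (∏ i, k i.succ (y i) (y' i)) * ∫⁻ x', k 0 x x' * h (Fin.cons x' y') ∂(μ 0)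
          ∂(Measure.pi fun i : Fin n => μ i.succ) := fun x => by
      rw [lintegral_pi_succ μ]
      · refine lintegral_congr fun y' => ?_
        rw [← lintegral_const_mul]
        · refine lintegral_congr fun x' => ?_
          rw [Fin.prod_univ_succ]
          simp only [Fin.cons_zero, Fin.cons_succ]
          ring
        · exact (hkm 0 measurable_const measurable_id).mul
            (hhc.comp (measurable_id.prodMk measurable_const))
      · exact (Finset.measurable_fun_prod _ fun i _ =>
          hkm i measurable_const (measurable_pi_apply i)).mul hh
    simp only [hstep]
    -- Minkowski brings the norm in `x` inside the integral over `y'`, where the product of the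
    -- other kernels is a constant factor.
    refine (rpow_lintegral_rpow_lintegral_le (μ 0) (Measure.pi fun i : Fin n => μ i.succ) (hp 0)
      (f := fun x y' => (∏ i, k i.succ (y i) (y' i)) *
        ∫⁻ x', k 0 x x' * h (Fin.cons x' y') ∂(μ 0))
      ((hK.comp measurable_snd).mul hA)).trans ?_
    refine lintegral_mono fun y' => ?_
    have hAy : Measurable fun x => ∫⁻ x', k 0 x x' * h (Fin.cons x' y') ∂(μ 0) :=
      hA.comp measurable_prodMk_right
    simp only [ENNReal.mul_rpow_of_nonneg _ _ h0.le]
    rw [lintegral_const_mul _ (hAy.pow_const _), ENNReal.mul_rpow_of_nonneg _ _ (by positivity),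
      ← ENNReal.rpow_mul, mul_one_div_cancel h0.ne', ENNReal.rpow_one]
    refine mul_le_mul_right (ENNReal.rpow_le_rpow ?_ (by positivity)) _
    exact lintegral_rpow_lintegral_mul_le (hp 0) (hk 0) (hk₁ 0) (hk₂ 0)
      (hhc.comp (measurable_prodMk_right (y := y')))

/-- Functions of finite mixed norm are finite almost everywhere. -/
theorem ae_lt_top_of_lpIter_ne_top {Ω : Fin n → Type u} [∀ i, MeasurableSpace (Ω i)]
    (μ : ∀ i, Measure (Ω i)) [∀ i, SigmaFinite (μ i)] (p : Fin n → ℝ) (hp : ∀ i, 1 ≤ p i)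
    {h : (∀ i, Ω i) → ℝ≥0∞} (hh : Measurable h) (hfin : lpIter μ p h ≠ ∞) :
    ∀ᵐ x ∂(Measure.pi μ), h x < ∞ := by
  induction n with
  | zero =>
    refine Eventually.of_forall fun x => ?_
    rw [Subsingleton.elim x (fun i => i.elim0)]
    exact lt_top_iff_ne_top.2 hfin
  | succ n ih =>
    have h0 : 0 < p 0 := lt_of_lt_of_le one_pos (hp 0)
    have h1 := ih _ _ (fun i => hp i.succ) (measurable_step μ (p 0) hh) hfin
    have hs : MeasurableSet {x : ∀ i, Ω i | h x < ∞} := hh measurableSet_Iio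
    -- The factors are swapped so that the outer quantifier runs over the remaining variables, as in
    -- the iteration.
    rw [← (measurePreserving_cons μ).map_eq, ae_map_iff measurable_cons.aemeasurable hs,
      ← Measure.prod_swap]
    refine (ae_map_iff measurable_swap.aemeasurable (hs.preimage measurable_cons)).2 ?_
    refine (Measure.ae_prod_iff_ae_ae (hs.preimage (measurable_cons.comp measurable_swap))).2 ?_
    filter_upwards [h1] with y hy
    have hc : Measurable (fun x : Ω 0 => (Fin.cons x y : ∀ i, Ω i)) :=
      measurable_cons.comp (measurable_id.prodMk measurable_const)
    rw [ENNReal.rpow_lt_top_iff_of_pos (by positivity)] at hy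
    filter_upwards [ae_lt_top ((hh.comp hc).pow_const (p 0)) hy.ne] with x hx
    exact (ENNReal.rpow_lt_top_iff_of_pos h0).1 hx

/-- **Dominated convergence** in mixed norms. -/
theorem tendsto_lpIter_zero_of_dominated {Ω : Fin n → Type u} [∀ i, MeasurableSpace (Ω i)]
    (μ : ∀ i, Measure (Ω i)) [∀ i, SigmaFinite (μ i)] (p : Fin n → ℝ) (hp : ∀ i, 1 ≤ p i)
    {h : ℕ → (∀ i, Ω i) → ℝ≥0∞} {H : (∀ i, Ω i) → ℝ≥0∞} (hh : ∀ k, Measurable (h k))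
    (hH : Measurable H) (hle : ∀ k, ∀ᵐ x ∂(Measure.pi μ), h k x ≤ H x) (hfin : lpIter μ p H ≠ ∞)
    (hlim : ∀ᵐ x ∂(Measure.pi μ), Tendsto (fun k => h k x) atTop (𝓝 0)) :
    Tendsto (fun k => lpIter μ p (h k)) atTop (𝓝 0) := by
  induction n with
  | zero =>
    -- With no variables the measure is a point mass, so an almost sure statement holds at the only
    -- point.
    rw [Measure.pi_of_empty μ (fun i => i.elim0)] at hlim
    by_contra hne
    have h2 := ae_iff.1 hlim
    rw [Measure.dirac_apply_of_mem (by exact hne)] at h2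
    exact one_ne_zero h2
  | succ n ih =>
    have h0 : 0 < p 0 := lt_of_lt_of_le one_pos (hp 0)
    have hc : ∀ y, Measurable (fun x : Ω 0 => (Fin.cons x y : ∀ i, Ω i)) := fun y =>
      measurable_cons.comp (measurable_id.prodMk measurable_const)
    -- For almost every `y` the slice of `H ^ p 0` is integrable, which permits ordinary dominated
    -- convergence in the first variable.
    have h1 := ae_lt_top_of_lpIter_ne_top _ _ (fun i => hp i.succ) (measurable_step μ (p 0) hH) hfin
    have hle' := ae_cons μ (ae_all_iff.2 hle)
    refine ih _ _ (fun i => hp i.succ) (fun k => measurable_step μ (p 0) (hh k))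
      (measurable_step μ (p 0) hH) (fun k => ?_) hfin ?_
    · filter_upwards [hle'] with y hy
      refine ENNReal.rpow_le_rpow (lintegral_mono_ae ?_) (by positivity)
      filter_upwards [hy] with x hx
      exact ENNReal.rpow_le_rpow (hx k) h0.le
    · filter_upwards [h1, hle', ae_cons μ hlim] with y hy hyle hylim
      rw [ENNReal.rpow_lt_top_iff_of_pos (by positivity)] at hy
      have h3 : Tendsto (fun k => ∫⁻ x, h k (Fin.cons x y) ^ p 0 ∂(μ 0)) atTop
          (𝓝 (∫⁻ _, 0 ∂(μ 0))) := by
        refine tendsto_lintegral_of_dominated_convergence (fun x => H (Fin.cons x y) ^ p 0)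
          (fun k => ((hh k).comp (hc y)).pow_const _) (fun k => ?_) hy.ne ?_
        · filter_upwards [hyle] with x hx
          exact ENNReal.rpow_le_rpow (hx k) h0.le
        · filter_upwards [hylim] with x hx
          have := ((ENNReal.continuous_rpow_const (y := p 0)).tendsto 0).comp hx
          rwa [ENNReal.zero_rpow_of_pos h0] at this
      rw [lintegral_zero] at h3
      have := ((ENNReal.continuous_rpow_const (y := 1 / p 0)).tendsto 0).comp h3
      rwa [ENNReal.zero_rpow_of_pos (by positivity)] at this

/-- The mixed norm of the indicator of a box of finite measure is finite. -/
theorem lpIter_indicator_pi_lt_top {Ω : Fin n → Type u} [∀ i, MeasurableSpace (Ω i)]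
    (μ : ∀ i, Measure (Ω i)) (p : Fin n → ℝ) (hp : ∀ i, 1 ≤ p i) {s : ∀ i, Set (Ω i)}
    (hs : ∀ i, MeasurableSet (s i)) (hμ : ∀ i, μ i (s i) < ∞) :
    lpIter μ p ((Set.univ.pi s).indicator 1) < ∞ := by
  induction n with
  | zero =>
    rw [lpIter, Set.indicator_of_mem (fun i _ => i.elim0)]
    exact ENNReal.one_lt_top
  | succ n ih =>
    have h0 : 0 < p 0 := lt_of_lt_of_le one_pos (hp 0)
    have hstep : ∀ y : ∀ i : Fin n, Ω i.succ,
        (∫⁻ x, (Set.univ.pi s).indicator (1 : (∀ i, Ω i) → ℝ≥0∞) (Fin.cons x y) ^ p 0 ∂(μ 0)) ^ (1 / p 0) =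
          μ 0 (s 0) ^ (1 / p 0) * (Set.univ.pi fun i : Fin n => s i.succ).indicator 1 y := fun y => by
      by_cases hy : y ∈ Set.univ.pi fun i : Fin n => s i.succ
      · rw [Set.indicator_of_mem hy, Pi.one_apply, mul_one, ← lintegral_indicator_one (hs 0)]
        congr 1
        refine lintegral_congr fun x => ?_
        by_cases hx : x ∈ s 0
        · have : (Fin.cons x y : ∀ i, Ω i) ∈ Set.univ.pi s := fun i _ =>
            Fin.cases hx (fun j => hy j trivial) i
          rw [Set.indicator_of_mem this, Set.indicator_of_mem hx, Pi.one_apply, Pi.one_apply,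
            ENNReal.one_rpow]
        · have : (Fin.cons x y : ∀ i, Ω i) ∉ Set.univ.pi s := fun h => hx (h 0 trivial)
          rw [Set.indicator_of_notMem this, Set.indicator_of_notMem hx, ENNReal.zero_rpow_of_pos h0]
      · have : ∀ x, (Fin.cons x y : ∀ i, Ω i) ∉ Set.univ.pi s := fun x h =>
          hy fun i _ => h i.succ trivial
        simp only [Set.indicator_of_notMem (this _), Set.indicator_of_notMem hy,
          ENNReal.zero_rpow_of_pos h0, lintegral_zero, mul_zero]
        exact ENNReal.zero_rpow_of_pos (by positivity)
    have hfin : μ 0 (s 0) ^ (1 / p 0) < ∞ := ENNReal.rpow_lt_top_of_nonneg (by positivity) (hμ 0).ne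
    rw [lpIter]
    simp only [hstep]
    rw [lpIter_const_mul _ _ (fun i => hp i.succ) hfin.ne]
    exact ENNReal.mul_lt_top hfin (ih _ _ (fun i => hp i.succ) (fun i => hs i.succ) fun i => hμ i.succ)

/-- Averaging over the boxes of finitely many cells contracts every mixed norm. -/
theorem lpIter_sum_indicator_mul_le {Ω : Fin n → Type u} [∀ i, MeasurableSpace (Ω i)]
    (μ : ∀ i, Measure (Ω i)) [∀ i, SigmaFinite (μ i)] (p : Fin n → ℝ) (hp : ∀ i, 1 ≤ p i)
    {ι : Fin n → Type*} (J : ∀ i, Finset (ι i)) {C : ∀ i, ι i → Set (Ω i)}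
    (hC : ∀ i j, MeasurableSet (C i j))
    (hdisj : ∀ i x, ∑ j ∈ J i, (C i j).indicator (1 : Ω i → ℝ≥0∞) x ≤ 1)
    {h : (∀ i, Ω i) → ℝ≥0∞} (hh : Measurable h) :
    lpIter μ p (fun x => ∑ c ∈ Fintype.piFinset J,
      (Set.univ.pi fun i => C i (c i)).indicator 1 x * ((∏ i, (μ i (C i (c i)))⁻¹) *
        ∫⁻ y in Set.univ.pi fun i => C i (c i), h y ∂(Measure.pi μ))) ≤ lpIter μ p h := by
  classical
  -- The kernel of conditional expectation on the cells of one factor. Expanding the product of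
  -- these sums gives the sum over boxes.
  set k : ∀ i, Ω i → Ω i → ℝ≥0∞ := fun i x y =>
    ∑ j ∈ J i, (C i j).indicator 1 x * ((C i j).indicator 1 y * (μ i (C i j))⁻¹)
  have hind : ∀ i j, Measurable ((C i j).indicator (1 : Ω i → ℝ≥0∞)) := fun i j =>
    measurable_one.indicator (hC i j)
  have hk : ∀ i, Measurable (Function.uncurry (k i)) := fun i =>
    Finset.measurable_fun_sum _ fun j _ =>
      ((hind i j).comp measurable_fst).mul (((hind i j).comp measurable_snd).mul_const _)
  have hk₁ : ∀ i x, ∫⁻ y, k i x y ∂(μ i) ≤ 1 := fun i x => by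
    refine le_trans ?_ (hdisj i x)
    rw [lintegral_finsetSum _ fun j _ => ((hind i j).mul_const _).const_mul _]
    refine Finset.sum_le_sum fun j _ => ?_
    rw [lintegral_const_mul _ ((hind i j).mul_const _), lintegral_mul_const _ (hind i j),
      lintegral_indicator_one (hC i j)]
    -- Null cells and cells of infinite measure do no harm, since `0 * ∞ = 0`.
    exact mul_le_of_le_one_right' (ENNReal.mul_inv_le_one _)
  -- The kernel is symmetric.
  have hk₂ : ∀ i y, ∫⁻ x, k i x y ∂(μ i) ≤ 1 := fun i y => by
    refine le_trans (lintegral_mono fun x => ?_) (hk₁ i y)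
    exact Finset.sum_le_sum fun j _ => by rw [mul_left_comm]
  have hpi : ∀ (c : ∀ i, ι i) (z : ∀ i, Ω i),
      (Set.univ.pi fun i => C i (c i)).indicator (1 : (∀ i, Ω i) → ℝ≥0∞) z =
        ∏ i, (C i (c i)).indicator 1 (z i) := fun c z => by
    simp only [Set.indicator_apply, Set.mem_univ_pi, Pi.one_apply]
    rw [Fintype.prod_ite_zero, Finset.prod_const_one]
    congr
  have hprod : ∀ x y : ∀ i, Ω i, ∏ i, k i (x i) (y i) = ∑ c ∈ Fintype.piFinset J,
      (Set.univ.pi fun i => C i (c i)).indicator 1 x * ((∏ i, (μ i (C i (c i)))⁻¹) *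
        (Set.univ.pi fun i => C i (c i)).indicator 1 y) := fun x y => by
    rw [Finset.prod_univ_sum]
    refine Finset.sum_congr rfl fun c _ => ?_
    rw [hpi, hpi, ← Finset.prod_mul_distrib, ← Finset.prod_mul_distrib]
    exact Finset.prod_congr rfl fun i _ => by ring
  refine (congrArg (lpIter μ p) (funext fun x => ?_)).trans_le
    (lpIter_lintegral_prod_mul_le μ p hp hk hk₁ hk₂ hh)
  have hbox : ∀ c : ∀ i, ι i, MeasurableSet (Set.univ.pi fun i => C i (c i)) := fun c =>
    MeasurableSet.univ_pi fun i => hC i (c i)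
  simp only [hprod, Finset.sum_mul, mul_assoc]
  have hm : ∀ c : ∀ i, ι i, Measurable fun y =>
      (Set.univ.pi fun i => C i (c i)).indicator 1 y * h y := fun c =>
    (measurable_one.indicator (hbox c)).mul hh
  rw [lintegral_finsetSum _ fun c _ => ((hm c).const_mul _).const_mul _]
  refine Finset.sum_congr rfl fun c _ => ?_
  rw [lintegral_const_mul _ ((hm c).const_mul _), lintegral_const_mul _ (hm c),
    ← lintegral_indicator (hbox c)]
  congr 2
  refine lintegral_congr fun y => ?_
  by_cases hy : y ∈ Set.univ.pi fun i => C i (c i)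
  · simp only [Set.indicator_of_mem hy, Pi.one_apply, one_mul]
  · simp only [Set.indicator_of_notMem hy, zero_mul]

/-- A function of finite mixed norm is integrable over boxes of finite measure. -/
theorem setLIntegral_pi_lt_top {Ω : Fin n → Type u} [∀ i, MeasurableSpace (Ω i)]
    (μ : ∀ i, Measure (Ω i)) [∀ i, SigmaFinite (μ i)] (p : Fin n → ℝ) (hp : ∀ i, 1 ≤ p i)
    {s : ∀ i, Set (Ω i)} (hs : ∀ i, MeasurableSet (s i)) (hμ : ∀ i, μ i (s i) < ∞)
    {h : (∀ i, Ω i) → ℝ≥0∞} (hh : Measurable h) (hfin : lpIter μ p h < ∞) :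
    ∫⁻ x in Set.univ.pi s, h x ∂(Measure.pi μ) < ∞ := by
  by_contra htop
  rw [not_lt_top_iff] at htop
  have hm : MeasurableSet (Set.univ.pi s) := MeasurableSet.univ_pi hs
  -- Average over the single box. An infinite integral would make the average infinite on the whole
  -- box although its mixed norm is finite; so the box is null and the integral is zero after all.
  have hc := lpIter_sum_indicator_mul_le μ p hp (fun _ => ({()} : Finset Unit))
    (C := fun i _ => s i) (fun i _ => hs i)
    (fun i x => by simpa using Set.indicator_le_self (s i) (1 : Ω i → ℝ≥0∞) x) hh
  have hne : ∏ i, (μ i (s i))⁻¹ ≠ 0 :=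
    Finset.prod_ne_zero_iff.2 fun i _ => ENNReal.inv_ne_zero.2 (hμ i).ne
  simp only [htop, ENNReal.mul_top hne, Finset.sum_const, nsmul_eq_mul] at hc
  have hlt := ae_lt_top_of_lpIter_ne_top μ p hp
    (((measurable_one.indicator hm).mul_const ∞).const_mul _) (hc.trans_lt hfin).ne
  have hnot : ∀ᵐ x ∂(Measure.pi μ), x ∉ Set.univ.pi s := by
    filter_upwards [hlt] with x hx hxs
    rw [Set.indicator_of_mem hxs] at hx
    simp at hx
  rw [Measure.restrict_eq_zero.2 (measure_eq_zero_iff_ae_notMem.2 hnot),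
    lintegral_zero_measure] at htop
  exact ENNReal.zero_ne_top htop

end Iterated

/-! ### Extension to almost everywhere measurable functions. -/

section AEMeasurable

variable {n : ℕ} {Ω : Fin n → Type u} [∀ i, MeasurableSpace (Ω i)]
  (μ : ∀ i, Measure (Ω i)) [∀ i, SigmaFinite (μ i)] (p : Fin n → ℝ)

theorem lpIter_mono_ae (hp : ∀ i, 1 ≤ p i) {g h : (∀ i, Ω i) → ℝ≥0∞}
    (hgh : ∀ᵐ x ∂(Measure.pi μ), g x ≤ h x) : lpIter μ p g ≤ lpIter μ p h := by
  have heq : g =ᵐ[Measure.pi μ] fun x => min (g x) (h x) := by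
    filter_upwards [hgh] with x hx
    rw [min_eq_left hx]
  rw [lpIter_congr_ae μ p heq]
  exact lpIter_mono μ p hp fun x => min_le_right _ _

theorem lpIter_sum_indicator_mul_le_of_aemeasurable (hp : ∀ i, 1 ≤ p i) {ι : Fin n → Type*}
    (J : ∀ i, Finset (ι i)) {C : ∀ i, ι i → Set (Ω i)} (hC : ∀ i j, MeasurableSet (C i j))
    (hdisj : ∀ i x, ∑ j ∈ J i, (C i j).indicator (1 : Ω i → ℝ≥0∞) x ≤ 1)
    {h : (∀ i, Ω i) → ℝ≥0∞} (hh : AEMeasurable h (Measure.pi μ)) :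
    lpIter μ p (fun x => ∑ c ∈ Fintype.piFinset J,
      (Set.univ.pi fun i => C i (c i)).indicator 1 x * ((∏ i, (μ i (C i (c i)))⁻¹) *
        ∫⁻ y in Set.univ.pi fun i => C i (c i), h y ∂(Measure.pi μ))) ≤ lpIter μ p h := by
  have heq : ∀ s, ∫⁻ y in s, h y ∂(Measure.pi μ) = ∫⁻ y in s, hh.mk h y ∂(Measure.pi μ) :=
    fun s => lintegral_congr_ae (ae_restrict_of_ae hh.ae_eq_mk)
  simp only [heq]
  rw [lpIter_congr_ae μ p hh.ae_eq_mk]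
  exact lpIter_sum_indicator_mul_le μ p hp J hC hdisj hh.measurable_mk

theorem setLIntegral_pi_lt_top_of_aemeasurable (hp : ∀ i, 1 ≤ p i) {s : ∀ i, Set (Ω i)}
    (hs : ∀ i, MeasurableSet (s i)) (hμ : ∀ i, μ i (s i) < ∞) {h : (∀ i, Ω i) → ℝ≥0∞}
    (hh : AEMeasurable h (Measure.pi μ)) (hfin : lpIter μ p h < ∞) :
    ∫⁻ x in Set.univ.pi s, h x ∂(Measure.pi μ) < ∞ := by
  rw [lpIter_congr_ae μ p hh.ae_eq_mk] at hfin
  rw [lintegral_congr_ae (ae_restrict_of_ae hh.ae_eq_mk)]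
  exact setLIntegral_pi_lt_top μ p hp hs hμ hh.measurable_mk hfin

theorem tendsto_lpIter_zero_of_dominated_of_aemeasurable (hp : ∀ i, 1 ≤ p i)
    {h : ℕ → (∀ i, Ω i) → ℝ≥0∞} {H : (∀ i, Ω i) → ℝ≥0∞}
    (hh : ∀ k, AEMeasurable (h k) (Measure.pi μ)) (hH : AEMeasurable H (Measure.pi μ))
    (hle : ∀ k, ∀ᵐ x ∂(Measure.pi μ), h k x ≤ H x) (hfin : lpIter μ p H < ∞)
    (hlim : ∀ᵐ x ∂(Measure.pi μ), Tendsto (fun k => h k x) atTop (𝓝 0)) :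
    Tendsto (fun k => lpIter μ p (h k)) atTop (𝓝 0) := by
  rw [lpIter_congr_ae μ p hH.ae_eq_mk] at hfin
  simp only [fun k => lpIter_congr_ae μ p (hh k).ae_eq_mk]
  refine tendsto_lpIter_zero_of_dominated μ p hp (fun k => (hh k).measurable_mk)
    hH.measurable_mk (fun k => ?_) hfin.ne ?_
  · filter_upwards [hle k, (hh k).ae_eq_mk, hH.ae_eq_mk] with x h1 h2 h3
    rwa [← h2, ← h3]
  · filter_upwards [hlim, ae_all_iff.2 fun k => (hh k).ae_eq_mk] with x h1 h2
    exact h1.congr h2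

end AEMeasurable

/-! ### Removal of the weight. -/

section Unweight

variable {n : ℕ} {Ω : Fin (n + 1) → Type u} [∀ i, MeasurableSpace (Ω i)]
  {𝕜 : Type*} [RCLike 𝕜] {μ : ∀ i, Measure (Ω i)} {p : Fin (n + 1) → ℝ} {w : Weight μ}

variable (p w) in
/-- The root `w ^ (1 / p₁)` of the weight, which turns the weighted norm into the unweighted one. -/
def Weight.root (x : ∀ i, Ω i) : ℝ := w.toFun x ^ (1 / p 0)

theorem Weight.root_pos (x : ∀ i, Ω i) : 0 < w.root p x := Real.rpow_pos_of_pos (w.pos x) _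

theorem Weight.ofReal_root_ne_zero (x : ∀ i, Ω i) : (w.root p x : 𝕜) ≠ 0 :=
  RCLike.ofReal_ne_zero.2 (Weight.root_pos x).ne'

theorem Weight.aestronglyMeasurable_root :
    AEStronglyMeasurable (fun x => (w.root p x : 𝕜)) (Measure.pi μ) :=
  RCLike.continuous_ofReal.comp_aestronglyMeasurable
    (w.aemeasurable.pow_const _).aestronglyMeasurable

/-- Since `w` is positive, its root can be absorbed into the function, which makes multiplication by
the root norm-preserving. -/
theorem mixedENorm_eq_lpIter_root (hp : ∀ i, 1 ≤ p i) (f : (∀ i, Ω i) → 𝕜) :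
    mixedENorm μ p w.toFun f = lpIter μ p fun x => ‖f x * (w.root p x : 𝕜)‖ₑ := by
  have h0 : 0 < p 0 := lt_of_lt_of_le one_pos (hp 0)
  rw [mixedENorm_eq_lpIter μ p hp]
  congr 1
  funext x
  rw [enorm_mul, ENNReal.ofReal_rpow_of_pos (w.pos x), ← ofReal_norm (w.root p x : 𝕜),
    RCLike.norm_ofReal, abs_of_pos (Weight.root_pos x), Weight.root]

variable [∀ i, SigmaFinite (μ i)] [Fact (∀ i, 1 ≤ p i)]

/-- The function `f w ^ (1 / p₁)` attached to an element `f` of the weighted space. -/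
def unweight (f : Space 𝕜 μ p w) (x : ∀ i, Ω i) : 𝕜 :=
  (f : (∀ i, Ω i) →ₘ[Measure.pi μ] 𝕜) x * (w.root p x : 𝕜)

theorem aestronglyMeasurable_unweight (f : Space 𝕜 μ p w) :
    AEStronglyMeasurable (unweight f) (Measure.pi μ) :=
  (AEEqFun.aestronglyMeasurable _).mul Weight.aestronglyMeasurable_root

theorem norm_eq_lpIter_unweight (f : Space 𝕜 μ p w) :
    ‖f‖ = (lpIter μ p fun x => ‖unweight f x‖ₑ).toReal := by
  rw [norm_def, mixedENorm_eq_lpIter_root Fact.out]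
  rfl

theorem lpIter_unweight_lt_top (f : Space 𝕜 μ p w) :
    lpIter μ p (fun x => ‖unweight f x‖ₑ) < ∞ := by
  have h : mixedENorm μ p w.toFun (f : (∀ i, Ω i) →ₘ[Measure.pi μ] 𝕜) < ∞ := f.2
  rwa [mixedENorm_eq_lpIter_root Fact.out] at h

theorem ext_unweight {f g : Space 𝕜 μ p w} (h : unweight f =ᵐ[Measure.pi μ] unweight g) :
    f = g := by
  refine Subtype.ext (AEEqFun.ext ?_)
  filter_upwards [h] with x hx
  exact mul_right_cancel₀ (Weight.ofReal_root_ne_zero x) hx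

theorem unweight_zero : unweight (0 : Space 𝕜 μ p w) =ᵐ[Measure.pi μ] 0 := by
  filter_upwards [AEEqFun.coeFn_zero (α := ∀ i, Ω i) (β := 𝕜) (μ := Measure.pi μ)] with x hx
  rw [unweight, Submodule.coe_zero, hx, Pi.zero_apply, zero_mul]

theorem unweight_add (f g : Space 𝕜 μ p w) :
    unweight (f + g) =ᵐ[Measure.pi μ] unweight f + unweight g := by
  filter_upwards [AEEqFun.coeFn_add (f : (∀ i, Ω i) →ₘ[Measure.pi μ] 𝕜) g] with x hx
  rw [unweight, Submodule.coe_add, hx, Pi.add_apply, add_mul]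
  rfl

theorem unweight_smul (c : 𝕜) (f : Space 𝕜 μ p w) :
    unweight (c • f) =ᵐ[Measure.pi μ] c • unweight f := by
  filter_upwards [AEEqFun.coeFn_smul c (f : (∀ i, Ω i) →ₘ[Measure.pi μ] 𝕜)] with x hx
  rw [unweight, Submodule.coe_smul, hx, Pi.smul_apply, smul_mul_assoc]
  rfl

theorem unweight_sub (f g : Space 𝕜 μ p w) :
    unweight (f - g) =ᵐ[Measure.pi μ] unweight f - unweight g := by
  filter_upwards [AEEqFun.coeFn_sub (f : (∀ i, Ω i) →ₘ[Measure.pi μ] 𝕜) g] with x hx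
  rw [unweight, Submodule.coe_sub, hx, Pi.sub_apply, sub_mul]
  rfl

theorem unweight_sum {ι : Type*} (s : Finset ι) (f : ι → Space 𝕜 μ p w) :
    unweight (∑ i ∈ s, f i) =ᵐ[Measure.pi μ] fun x => ∑ i ∈ s, unweight (f i) x := by
  classical
  induction s using Finset.induction_on with
  | empty =>
    simp only [Finset.sum_empty]
    exact unweight_zero
  | insert a s ha ih =>
    rw [Finset.sum_insert ha]
    filter_upwards [unweight_add (f a) (∑ i ∈ s, f i), ih] with x h1 h2
    rw [h1, Pi.add_apply, h2, Finset.sum_insert ha]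

/-- Every function of finite unweighted mixed norm comes from the weighted space. -/
theorem exists_unweight_eq (w : Weight μ) {g : (∀ i, Ω i) → 𝕜}
    (hg : AEStronglyMeasurable g (Measure.pi μ)) (hfin : lpIter μ p (fun x => ‖g x‖ₑ) < ∞) :
    ∃ f : Space 𝕜 μ p w, unweight f =ᵐ[Measure.pi μ] g := by
  have hm : AEStronglyMeasurable (fun x => g x * (w.root p x : 𝕜)⁻¹) (Measure.pi μ) :=
    hg.mul (Weight.aestronglyMeasurable_root (p := p)).aemeasurable.inv.aestronglyMeasurable
  have hae : ∀ᵐ x ∂(Measure.pi μ), AEEqFun.mk _ hm x * (w.root p x : 𝕜) = g x := by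
    filter_upwards [AEEqFun.coeFn_mk _ hm] with x hx
    rw [hx, inv_mul_cancel_right₀ (Weight.ofReal_root_ne_zero x)]
  refine ⟨⟨AEEqFun.mk _ hm, ?_⟩, hae⟩
  change mixedENorm μ p w.toFun _ < ∞
  rw [mixedENorm_eq_lpIter_root Fact.out]
  refine (lpIter_congr_ae μ p ?_).trans_lt hfin
  filter_upwards [hae] with x hx
  rw [hx]

/-- The indicator of a box of finite measure, as an element of the weighted space. -/
theorem exists_unweight_eq_indicator_pi (𝕜 : Type*) [RCLike 𝕜] (w : Weight μ) {s : ∀ i, Set (Ω i)}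
    (hs : ∀ i, MeasurableSet (s i)) (hμ : ∀ i, μ i (s i) < ∞) :
    ∃ f : Space 𝕜 μ p w, unweight f =ᵐ[Measure.pi μ] (Set.univ.pi s).indicator 1 := by
  refine exists_unweight_eq w
    (stronglyMeasurable_one.indicator (MeasurableSet.univ_pi hs)).aestronglyMeasurable ?_
  refine lt_of_eq_of_lt ?_ (lpIter_indicator_pi_lt_top μ p Fact.out hs hμ)
  congr 1
  funext x
  simp only [enorm_indicator_eq_indicator_enorm, Pi.one_apply, enorm_one]
  rfl

/-- This makes the averages over boxes additive in `f`, as they are Bochner integrals. -/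
theorem integrableOn_unweight (f : Space 𝕜 μ p w) {s : ∀ i, Set (Ω i)}
    (hs : ∀ i, MeasurableSet (s i)) (hμ : ∀ i, μ i (s i) < ∞) :
    IntegrableOn (unweight f) (Set.univ.pi s) (Measure.pi μ) :=
  ⟨(aestronglyMeasurable_unweight f).restrict,
    setLIntegral_pi_lt_top_of_aemeasurable μ p Fact.out hs hμ
      (aestronglyMeasurable_unweight f).enorm (lpIter_unweight_lt_top f)⟩

/-- **Dominated convergence** in the weighted space. -/
theorem tendsto_of_dominated {F : ℕ → Space 𝕜 μ p w} {f : Space 𝕜 μ p w}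
    {G : (∀ i, Ω i) → ℝ≥0∞} (hG : AEMeasurable G (Measure.pi μ)) (hfin : lpIter μ p G < ∞)
    (hle : ∀ k, ∀ᵐ x ∂(Measure.pi μ), ‖unweight (F k) x - unweight f x‖ₑ ≤ G x)
    (hlim : ∀ᵐ x ∂(Measure.pi μ), Tendsto (fun k => unweight (F k) x) atTop (𝓝 (unweight f x))) :
    Tendsto F atTop (𝓝 f) := by
  rw [tendsto_iff_norm_sub_tendsto_zero]
  have hnorm : ∀ k, ‖F k - f‖ =
      (lpIter μ p fun x => ‖unweight (F k) x - unweight f x‖ₑ).toReal := fun k => by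
    rw [norm_eq_lpIter_unweight]
    congr 1
    refine lpIter_congr_ae μ p ?_
    filter_upwards [unweight_sub (F k) f] with x hx
    rw [hx, Pi.sub_apply]
  simp only [hnorm]
  rw [← ENNReal.toReal_zero]
  refine (ENNReal.tendsto_toReal ENNReal.zero_ne_top).comp
    (tendsto_lpIter_zero_of_dominated_of_aemeasurable μ p Fact.out (fun k =>
      ((aestronglyMeasurable_unweight _).sub (aestronglyMeasurable_unweight _)).enorm) hG hle hfin ?_)
  filter_upwards [hlim] with x hx
  have := (tendsto_sub_nhds_zero_iff.2 hx).enorm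
  rwa [enorm_zero] at this

end Unweight

/-! ### The averaging operators. -/

section Averaging

variable {n : ℕ} {Ω : Fin (n + 1) → Type u} [∀ i, MeasurableSpace (Ω i)]
  {μ : ∀ i, Measure (Ω i)} {p : Fin (n + 1) → ℝ} [∀ i, SigmaFinite (μ i)] [Fact (∀ i, 1 ≤ p i)]

/-- Averaging over the boxes of finitely many disjoint cells of finite measure is a contraction of
finite rank. -/
theorem exists_averaging (𝕜 : Type*) [RCLike 𝕜] (w : Weight μ) {ι : Fin (n + 1) → Type*}
    (J : ∀ i, Finset (ι i)) {C : ∀ i, ι i → Set (Ω i)} (hC : ∀ i j, MeasurableSet (C i j))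
    (hμ : ∀ i j, μ i (C i j) < ∞)
    (hdisj : ∀ i x, ∑ j ∈ J i, (C i j).indicator (1 : Ω i → ℝ≥0∞) x ≤ 1) :
    ∃ T : Space 𝕜 μ p w →L[𝕜] Space 𝕜 μ p w,
      FiniteDimensional 𝕜 (LinearMap.range (T : Space 𝕜 μ p w →ₗ[𝕜] Space 𝕜 μ p w)) ∧ ‖T‖ ≤ 1 ∧
      ∀ f, unweight (T f) =ᵐ[Measure.pi μ] fun x => ∑ c ∈ Fintype.piFinset J,
        (((∏ i, (μ i (C i (c i)))⁻¹).toReal : 𝕜) *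
          ∫ y in Set.univ.pi fun i => C i (c i), unweight f y ∂(Measure.pi μ)) *
            (Set.univ.pi fun i => C i (c i)).indicator 1 x := by
  choose e he using fun c : ∀ i, ι i =>
    exists_unweight_eq_indicator_pi (p := p) 𝕜 w (fun i => hC i (c i)) (fun i => hμ i (c i))
  -- The mean of `unweight f` over the box of `c`, or zero if the box is null; it is the coefficient
  -- of `e c`.
  set a : (∀ i, ι i) → Space 𝕜 μ p w → 𝕜 := fun c f =>
    ((∏ i, (μ i (C i (c i)))⁻¹).toReal : 𝕜) *
      ∫ y in Set.univ.pi fun i => C i (c i), unweight f y ∂(Measure.pi μ) with ha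
  have hint : ∀ (c : ∀ i, ι i) (f : Space 𝕜 μ p w), Integrable (unweight f)
      ((Measure.pi μ).restrict (Set.univ.pi fun i => C i (c i))) := fun c f =>
    integrableOn_unweight f (fun i => hC i (c i)) (fun i => hμ i (c i))
  have hadd : ∀ c f g, a c (f + g) = a c f + a c g := fun c f g => by
    simp only [ha]
    rw [integral_congr_ae (ae_restrict_of_ae (unweight_add f g)), integral_add' (hint c f) (hint c g),
      mul_add]
  have hsmul : ∀ c (r : 𝕜) f, a c (r • f) = r * a c f := fun c r f => by
    simp only [ha]
    rw [integral_congr_ae (ae_restrict_of_ae (unweight_smul r f))]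
    simp only [Pi.smul_apply, smul_eq_mul]
    rw [integral_const_mul]
    ring
  let T₀ : Space 𝕜 μ p w →ₗ[𝕜] Space 𝕜 μ p w :=
    { toFun := fun f => ∑ c ∈ Fintype.piFinset J, a c f • e c
      map_add' := fun f g => by
        simp only [hadd, add_smul, Finset.sum_add_distrib]
      map_smul' := fun r f => by
        simp only [hsmul, mul_smul, Finset.smul_sum, RingHom.id_apply] }
  have hT₀ : ∀ f, unweight (T₀ f) =ᵐ[Measure.pi μ] fun x => ∑ c ∈ Fintype.piFinset J,
      a c f * (Set.univ.pi fun i => C i (c i)).indicator 1 x := fun f => by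
    filter_upwards [unweight_sum (Fintype.piFinset J) fun c => a c f • e c,
      (ae_ball_iff (Fintype.piFinset J).countable_toSet).2 fun c _ => unweight_smul (a c f) (e c),
      (ae_ball_iff (Fintype.piFinset J).countable_toSet).2 fun c _ => he c] with x h1 h2 h3
    refine h1.trans (Finset.sum_congr rfl fun c hc => ?_)
    rw [h2 c hc, Pi.smul_apply, h3 c hc, smul_eq_mul]
  have hbound : ∀ f, ‖T₀ f‖ ≤ 1 * ‖f‖ := fun f => by
    rw [one_mul, norm_eq_lpIter_unweight, norm_eq_lpIter_unweight]
    refine ENNReal.toReal_mono (lpIter_unweight_lt_top f).ne ?_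
    -- Pointwise, the averaged function is at most the average of the absolute value, to which the
    -- contraction estimate applies.
    refine le_trans (lpIter_mono_ae μ p Fact.out ?_)
      (lpIter_sum_indicator_mul_le_of_aemeasurable μ p Fact.out J hC hdisj
        (aestronglyMeasurable_unweight f).enorm)
    filter_upwards [hT₀ f] with x hx
    rw [hx]
    refine (enorm_sum_le _ _).trans (Finset.sum_le_sum fun c _ => ?_)
    rw [enorm_mul, mul_comm]
    refine mul_le_mul' (le_of_eq ?_) ?_
    · simp only [enorm_indicator_eq_indicator_enorm, Pi.one_apply, enorm_one]
      rfl
    · simp only [ha, enorm_mul]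
      refine mul_le_mul' ?_ (enorm_integral_le_lintegral_enorm _)
      rw [← ofReal_norm, RCLike.norm_ofReal, abs_of_nonneg ENNReal.toReal_nonneg]
      -- Only an inequality: for a null cell the product of inverses is `∞`, with `toReal` equal to
      -- `0`.
      exact ENNReal.ofReal_toReal_le
  refine ⟨T₀.mkContinuous 1 hbound, ?_, T₀.mkContinuous_norm_le zero_le_one hbound, hT₀⟩
  have hle : LinearMap.range (T₀.mkContinuous 1 hbound : Space 𝕜 μ p w →ₗ[𝕜] Space 𝕜 μ p w) ≤
      Submodule.span 𝕜 (e '' (Fintype.piFinset J : Set (∀ i, ι i))) := by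
    rintro _ ⟨f, rfl⟩
    exact Submodule.sum_mem _ fun c hc =>
      Submodule.smul_mem _ _ (Submodule.subset_span ⟨c, hc, rfl⟩)
  have : FiniteDimensional 𝕜
      (Submodule.span 𝕜 (e '' (Fintype.piFinset J : Set (∀ i, ι i)))) :=
    FiniteDimensional.span_of_finite 𝕜 ((Fintype.piFinset J).finite_toSet.image e)
  exact Submodule.finiteDimensional_of_le hle

/-- Averaging over the boxes of cells reproduces the indicators of boxes composed of cells. -/
theorem sum_setIntegral_indicator_ae_eq (𝕜 : Type*) [RCLike 𝕜] {ι : Fin (n + 1) → Type*}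
    (J : ∀ i, Finset (ι i)) {C : ∀ i, ι i → Set (Ω i)} (hC : ∀ i j, MeasurableSet (C i j))
    (hμ : ∀ i j, μ i (C i j) < ∞) (huniq : ∀ i x j j', x ∈ C i j → x ∈ C i j' → j = j')
    {s : ∀ i, Set (Ω i)} (hcov : ∀ i, ∀ x ∈ s i, ∃ j ∈ J i, x ∈ C i j)
    (hcell : ∀ i j, ∀ x ∈ C i j, ∀ y ∈ C i j, x ∈ s i → y ∈ s i) :
    (fun x => ∑ c ∈ Fintype.piFinset J, (((∏ i, (μ i (C i (c i)))⁻¹).toReal : 𝕜) *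
      ∫ y in Set.univ.pi fun i => C i (c i), (Set.univ.pi s).indicator (1 : (∀ i, Ω i) → 𝕜) y
        ∂(Measure.pi μ)) * (Set.univ.pi fun i => C i (c i)).indicator 1 x) =ᵐ[Measure.pi μ]
      (Set.univ.pi s).indicator 1 := by
  -- Null boxes carry the coefficient `0`, so points lying in them are discarded.
  have hnull : ∀ᵐ x ∂(Measure.pi μ), ∀ c ∈ Fintype.piFinset J,
      Measure.pi μ (Set.univ.pi fun i => C i (c i)) = 0 → x ∉ Set.univ.pi fun i => C i (c i) := by
    refine (ae_ball_iff (Fintype.piFinset J).countable_toSet).2 fun c _ => ?_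
    by_cases h : Measure.pi μ (Set.univ.pi fun i => C i (c i)) = 0
    · filter_upwards [measure_eq_zero_iff_ae_notMem.1 h] with x hx _ using hx
    · exact Eventually.of_forall fun x h' => absurd h' h
  filter_upwards [hnull] with x hx
  by_cases hex : ∃ c ∈ Fintype.piFinset J, x ∈ Set.univ.pi fun i => C i (c i)
  · obtain ⟨c, hc, hxc⟩ := hex
    -- Distinct boxes of cells are disjoint, so only the one containing `x` contributes; the
    -- indicator of `s` is constant on it.
    rw [Finset.sum_eq_single_of_mem c hc]
    · have hind : ∀ y ∈ Set.univ.pi fun i => C i (c i),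
          (Set.univ.pi s).indicator (1 : (∀ i, Ω i) → 𝕜) y = (Set.univ.pi s).indicator 1 x := by
        intro y hy
        have hiff : y ∈ Set.univ.pi s ↔ x ∈ Set.univ.pi s :=
          ⟨fun h i hi => hcell i (c i) _ (hy i hi) _ (hxc i hi) (h i hi),
            fun h i hi => hcell i (c i) _ (hxc i hi) _ (hy i hi) (h i hi)⟩
        by_cases h : x ∈ Set.univ.pi s
        · rw [Set.indicator_of_mem h, Set.indicator_of_mem (hiff.2 h)]
          rfl
        · rw [Set.indicator_of_notMem h, Set.indicator_of_notMem (mt hiff.1 h)]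
      have hpos : ∀ i, μ i (C i (c i)) ≠ 0 := fun i h => by
        refine hx c hc ?_ hxc
        rw [Measure.pi_pi]
        exact Finset.prod_eq_zero (Finset.mem_univ i) h
      rw [setIntegral_congr_fun (MeasurableSet.univ_pi fun i => hC i (c i)) hind,
        setIntegral_const, Set.indicator_of_mem hxc, Pi.one_apply, mul_one, RCLike.real_smul_eq_coe_mul,
        ← mul_assoc, ← RCLike.ofReal_mul, Measure.real, Measure.pi_pi, ENNReal.toReal_prod,
        ENNReal.toReal_prod, ← Finset.prod_mul_distrib, Finset.prod_eq_one, RCLike.ofReal_one, one_mul]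
      intro i _
      rw [ENNReal.toReal_inv, inv_mul_cancel₀]
      exact (ENNReal.toReal_pos (hpos i) (hμ i _).ne).ne'
    · intro c' _ hne
      rw [Set.indicator_of_notMem, mul_zero]
      exact fun h => hne (funext fun i => huniq i (x i) _ _ (h i trivial) (hxc i trivial))
  -- The cells cover the sides of the box, so a point outside all boxes of cells lies outside `s`
  -- and both sides vanish.
  · have hxs : x ∉ Set.univ.pi s := fun h => hex <| by
      choose c hc hxc using fun i => hcov i (x i) (h i trivial)
      exact ⟨c, Fintype.mem_piFinset.2 hc, fun i _ => hxc i⟩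
    rw [Set.indicator_of_notMem hxs]
    refine Finset.sum_eq_zero fun c hc => ?_
    rw [Set.indicator_of_notMem (fun h => hex ⟨c, hc, h⟩), mul_zero]

end Averaging

/-! ### Density of the span of boxes. -/

section Density

variable {n : ℕ} {Ω : Fin (n + 1) → Type u} [∀ i, MeasurableSpace (Ω i)]
  {𝕜 : Type*} [RCLike 𝕜] {μ : ∀ i, Measure (Ω i)} {p : Fin (n + 1) → ℝ} {w : Weight μ}
  [∀ i, SigmaFinite (μ i)] [Fact (∀ i, 1 ≤ p i)]

variable (𝕜 μ p w) in
/-- The elements of the weighted space given by the indicators of boxes of finite measure. -/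
def boxes : Set (Space 𝕜 μ p w) :=
  {f | ∃ s : ∀ i, Set (Ω i), (∀ i, MeasurableSet (s i)) ∧ (∀ i, μ i (s i) < ∞) ∧
    unweight f =ᵐ[Measure.pi μ] (Set.univ.pi s).indicator 1}

/-- Indicators of measurable subsets of a box are limits of combinations of boxes. -/
theorem exists_mem_unweight_eq_indicator {S : Submodule 𝕜 (Space 𝕜 μ p w)}
    (hS : IsClosed (S : Set (Space 𝕜 μ p w))) (hbox : boxes 𝕜 μ p w ⊆ S) {s : ∀ i, Set (Ω i)}
    (hs : ∀ i, MeasurableSet (s i)) (hμ : ∀ i, μ i (s i) < ∞) {E : Set (∀ i, Ω i)}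
    (hE : MeasurableSet E) :
    ∃ f ∈ S, unweight f =ᵐ[Measure.pi μ] (E ∩ Set.univ.pi s).indicator 1 := by
  -- Dynkin's π-λ theorem. Intersecting with a fixed box of finite measure keeps all indicators in
  -- the space, even for complements.
  refine MeasurableSpace.induction_on_inter (C := fun E _ => ∃ f ∈ S,
    unweight f =ᵐ[Measure.pi μ] (E ∩ Set.univ.pi s).indicator 1)
    generateFrom_pi.symm isPiSystem_pi ?_ (fun t ht => ?_) (fun t ht ih => ?_)
    (fun t hdisj ht ih => ?_) E hE
  · refine ⟨0, S.zero_mem, ?_⟩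
    rw [Set.empty_inter, Set.indicator_empty]
    exact unweight_zero
  · obtain ⟨t, ht, rfl⟩ := ht
    have hm : ∀ i, MeasurableSet (t i ∩ s i) := fun i => (ht i trivial).inter (hs i)
    have hfin : ∀ i, μ i (t i ∩ s i) < ∞ := fun i =>
      (measure_mono Set.inter_subset_right).trans_lt (hμ i)
    obtain ⟨f, hf⟩ := exists_unweight_eq_indicator_pi (p := p) 𝕜 w hm hfin
    exact ⟨f, hbox ⟨_, hm, hfin, hf⟩, by rwa [← Set.pi_inter_distrib]⟩
  · obtain ⟨f, hfS, hf⟩ := ih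
    obtain ⟨g, hg⟩ := exists_unweight_eq_indicator_pi (p := p) 𝕜 w hs hμ
    refine ⟨g - f, S.sub_mem (hbox ⟨_, hs, hμ, hg⟩) hfS, ?_⟩
    filter_upwards [unweight_sub g f, hf, hg] with x h1 h2 h3
    rw [h1, Pi.sub_apply, h2, h3]
    by_cases hx : x ∈ Set.univ.pi s <;> by_cases hxt : x ∈ t <;> simp [Set.indicator, hx, hxt]
  · choose F hFS hF using ih
    have hm : MeasurableSet ((⋃ k, t k) ∩ Set.univ.pi s) :=
      (MeasurableSet.iUnion ht).inter (MeasurableSet.univ_pi hs)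
    have hle : ∀ (A : Set (∀ i, Ω i)) (x : ∀ i, Ω i), A ⊆ Set.univ.pi s →
        ‖A.indicator (1 : (∀ i, Ω i) → 𝕜) x‖ₑ ≤ (Set.univ.pi s).indicator 1 x := fun A x hA => by
      simp only [enorm_indicator_eq_indicator_enorm, Pi.one_apply, enorm_one]
      exact Set.indicator_le_indicator_of_subset hA (fun _ => zero_le) x
    obtain ⟨f, hf⟩ := exists_unweight_eq (p := p) w
      (stronglyMeasurable_one (β := 𝕜).indicator hm).aestronglyMeasurable
      ((lpIter_mono μ p Fact.out fun x => hle _ x Set.inter_subset_right).trans_lt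
        (lpIter_indicator_pi_lt_top μ p Fact.out hs hμ))
    refine ⟨f, ?_, hf⟩
    have hsum : ∀ k, unweight (∑ j ∈ Finset.range k, F j) =ᵐ[Measure.pi μ]
        ((⋃ j ∈ Finset.range k, t j) ∩ Set.univ.pi s).indicator 1 := fun k => by
      filter_upwards [unweight_sum (Finset.range k) F, ae_all_iff.2 hF] with x h1 h2
      rw [h1, Set.iUnion₂_inter, Finset.indicator_biUnion_apply]
      · exact Finset.sum_congr rfl fun j _ => h2 j
      · exact fun i _ j _ hij => (hdisj hij).mono Set.inter_subset_left Set.inter_subset_left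
    -- The partial sums converge in norm, dominated by the indicator of the fixed box.
    refine hS.mem_of_tendsto (tendsto_of_dominated
      (F := fun k => ∑ j ∈ Finset.range k, F j) (G := (Set.univ.pi s).indicator 1)
      (measurable_one.indicator (MeasurableSet.univ_pi hs)).aemeasurable
      (lpIter_indicator_pi_lt_top μ p Fact.out hs hμ) (fun k => ?_) ?_)
      (Eventually.of_forall fun k => S.sum_mem fun j _ => hFS j)
    · filter_upwards [hsum k, hf] with x h1 h2
      have hsub : (⋃ j ∈ Finset.range k, t j) ∩ Set.univ.pi s ⊆ (⋃ j, t j) ∩ Set.univ.pi s :=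
        Set.inter_subset_inter_left _ (Set.iUnion₂_subset_iUnion _ _)
      rw [h1, h2, ← enorm_neg, neg_sub]
      refine le_trans (le_of_eq ?_) (hle _ x ((Set.sdiff_subset (s := (⋃ j, t j) ∩ Set.univ.pi s)
        (t := (⋃ j ∈ Finset.range k, t j) ∩ Set.univ.pi s)).trans Set.inter_subset_right))
      rw [Set.indicator_sdiff hsub, Pi.sub_apply]
    · filter_upwards [ae_all_iff.2 hsum, hf] with x h1 h2
      simp only [h1, h2, Set.iUnion_inter]
      exact ((tendsto_indicator_biUnion_finset (fun j => t j ∩ Set.univ.pi s) 1 x).comp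
        tendsto_finset_range).mono_right (pure_le_nhds _)

theorem exists_mem_unweight_eq_indicator_simpleFunc {S : Submodule 𝕜 (Space 𝕜 μ p w)}
    (hS : IsClosed (S : Set (Space 𝕜 μ p w))) (hbox : boxes 𝕜 μ p w ⊆ S) {s : ∀ i, Set (Ω i)}
    (hs : ∀ i, MeasurableSet (s i)) (hμ : ∀ i, μ i (s i) < ∞) (g : SimpleFunc (∀ i, Ω i) 𝕜) :
    ∃ f ∈ S, unweight f =ᵐ[Measure.pi μ] (Set.univ.pi s).indicator g := by
  induction g using SimpleFunc.induction with
  | const c hE =>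
    obtain ⟨f, hfS, hf⟩ := exists_mem_unweight_eq_indicator hS hbox hs hμ hE
    refine ⟨c • f, S.smul_mem c hfS, ?_⟩
    filter_upwards [unweight_smul c f, hf] with x h1 h2
    rw [h1, Pi.smul_apply, h2]
    simp only [Set.indicator, Set.mem_inter_iff, SimpleFunc.coe_piecewise, Set.piecewise]
    split_ifs <;> simp_all
  | @add g₁ g₂ _ h₁ h₂ =>
    obtain ⟨f₁, hS₁, hf₁⟩ := h₁
    obtain ⟨f₂, hS₂, hf₂⟩ := h₂
    refine ⟨f₁ + f₂, S.add_mem hS₁ hS₂, ?_⟩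
    filter_upwards [unweight_add f₁ f₂, hf₁, hf₂] with x h1 h2 h3
    rw [h1, Pi.add_apply, h2, h3, SimpleFunc.coe_add, Set.indicator_add', Pi.add_apply]

/-- Combinations of indicators of boxes of finite measure are dense. -/
theorem topologicalClosure_span_boxes :
    (Submodule.span 𝕜 (boxes 𝕜 μ p w)).topologicalClosure = ⊤ := by
  set S := (Submodule.span 𝕜 (boxes 𝕜 μ p w)).topologicalClosure
  have hS : IsClosed (S : Set (Space 𝕜 μ p w)) := Submodule.isClosed_topologicalClosure _
  have hbox : boxes 𝕜 μ p w ⊆ S :=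
    Submodule.subset_span.trans (Submodule.le_topologicalClosure _)
  refine eq_top_iff.2 fun f _ => ?_
  borelize 𝕜
  have hae := aestronglyMeasurable_unweight f
  set g := hae.mk (unweight f)
  have hg : Measurable g := hae.stronglyMeasurable_mk.measurable
  -- These simple functions need not have finite mixed norm, so `φ k` is cut off to the `k`-th box
  -- of spanning sets.
  set φ : ℕ → SimpleFunc (∀ i, Ω i) 𝕜 := SimpleFunc.approxOn g hg Set.univ 0 trivial
  choose F hFS hF using fun k => exists_mem_unweight_eq_indicator_simpleFunc hS hbox
    (fun i => measurableSet_spanningSets (μ i) k) (fun i => measure_spanningSets_lt_top (μ i) k) (φ k)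
  -- The `3` arises from `|φ k| ≤ 2 |g|` together with the subtracted `g`.
  refine hS.mem_of_tendsto (tendsto_of_dominated (F := F) (G := fun x => 3 * ‖unweight f x‖ₑ)
    (hae.enorm.const_mul 3) ?_ (fun k => ?_) ?_) (Eventually.of_forall hFS)
  · rw [lpIter_const_mul μ p Fact.out (by finiteness)]
    exact ENNReal.mul_lt_top (by finiteness) (lpIter_unweight_lt_top f)
  · filter_upwards [hF k, hae.ae_eq_mk] with x h1 h2
    rw [h1, h2]
    have hφ : ‖φ k x‖ₑ ≤ ‖g x‖ₑ + ‖g x‖ₑ := by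
      have := SimpleFunc.norm_approxOn_zero_le hg (s := Set.univ) trivial x k
      rw [← ofReal_norm, ← ofReal_norm, ← ENNReal.ofReal_add (norm_nonneg _) (norm_nonneg _)]
      exact ENNReal.ofReal_le_ofReal this
    calc ‖(Set.univ.pi fun i => spanningSets (μ i) k).indicator (φ k) x - g x‖ₑ
        ≤ ‖(Set.univ.pi fun i => spanningSets (μ i) k).indicator (φ k) x‖ₑ + ‖g x‖ₑ := enorm_sub_le
      _ ≤ (‖g x‖ₑ + ‖g x‖ₑ) + ‖g x‖ₑ := by
          gcongr
          refine le_trans ?_ hφ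
          rw [enorm_indicator_eq_indicator_enorm]
          exact Set.indicator_le_self _ _ x
      _ = 3 * ‖g x‖ₑ := by ring
  · filter_upwards [ae_all_iff.2 hF, hae.ae_eq_mk] with x h1 h2
    simp only [h1]
    rw [h2]
    refine (SimpleFunc.tendsto_approxOn hg (s := Set.univ) (y₀ := 0) trivial (by simp)).congr' ?_
    have hev : ∀ i, ∀ᶠ k in atTop, x i ∈ spanningSets (μ i) k := fun i => by
      filter_upwards [eventually_ge_atTop (spanningSetsIndex (μ i) (x i))] with k hk
      exact monotone_spanningSets (μ i) hk (mem_spanningSetsIndex (μ i) (x i))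
    -- There are finitely many coordinates, so the cut-off box eventually contains `x`.
    filter_upwards [eventually_all.2 hev] with k hk
    have hmem : x ∈ Set.univ.pi fun i => spanningSets (μ i) k := fun i _ => hk i
    exact (Set.indicator_of_mem hmem _).symm

end Density

/-! ### Atoms of finite families of sets. -/

section Cells

variable {α : Type*} [MeasurableSpace α] {μ : Measure α}

variable (μ) in
/-- The measurable sets of finite measure. -/
abbrev FiniteMeasureSet : Type _ := {A : Set α // MeasurableSet A ∧ μ A < ∞}

/-- The set of points which belong to precisely the members `j` of a finite family `t`. -/
def cell (t j : Finset (FiniteMeasureSet μ)) : Set α :=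
  {x | j.Nonempty ∧ j ⊆ t ∧ ∀ A ∈ t, A ∈ j ↔ x ∈ A.1}

theorem measurableSet_cell (t j : Finset (FiniteMeasureSet μ)) : MeasurableSet (cell t j) := by
  refine (MeasurableSet.const _).inter ((MeasurableSet.const _).inter ?_)
  have : {x | ∀ A ∈ t, A ∈ j ↔ x ∈ A.1} = ⋂ A ∈ t, {x | A ∈ j ↔ x ∈ A.1} := by
    ext x
    simp
  change MeasurableSet {x | ∀ A ∈ t, A ∈ j ↔ x ∈ A.1}
  rw [this]
  refine t.measurableSet_biInter fun A _ => ?_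
  by_cases h : A ∈ j
  · simpa only [h, true_iff] using! A.2.1
  · simpa only [h, false_iff] using! A.2.1.compl

/-- A cell lies in some member of `t` because `j` is nonempty; the excluded atom, outside all
members, may have infinite measure. -/
theorem measure_cell_lt_top (t j : Finset (FiniteMeasureSet μ)) : μ (cell t j) < ∞ := by
  by_cases h : j.Nonempty ∧ j ⊆ t
  · obtain ⟨⟨A, hA⟩, hj⟩ := h
    exact (measure_mono fun x hx => (hx.2.2 A (hj hA)).1 hA).trans_lt A.2.2
  · have : cell t j = ∅ := Set.eq_empty_of_forall_notMem fun x hx => h ⟨hx.1, hx.2.1⟩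
    rw [this, measure_empty]
    exact ENNReal.zero_lt_top

/-- A point determines its index as the set of members of `t` containing it; the condition `j ⊆ t`
rules out other labels. -/
theorem eq_of_mem_cell {t j j' : Finset (FiniteMeasureSet μ)} {x : α} (h : x ∈ cell t j)
    (h' : x ∈ cell t j') : j = j' := by
  ext A
  exact ⟨fun hA => (h'.2.2 A (h.2.1 hA)).2 ((h.2.2 A (h.2.1 hA)).1 hA),
    fun hA => (h.2.2 A (h'.2.1 hA)).2 ((h'.2.2 A (h'.2.1 hA)).1 hA)⟩

theorem exists_mem_cell {t : Finset (FiniteMeasureSet μ)} {A : FiniteMeasureSet μ} (hA : A ∈ t)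
    {x : α} (hx : x ∈ A.1) : ∃ j ∈ t.powerset, x ∈ cell t j := by
  classical
  have hj : t.filter (fun B => x ∈ B.1) ⊆ t := Finset.filter_subset _ _
  refine ⟨t.filter fun B => x ∈ B.1, Finset.mem_powerset.2 hj,
    ⟨A, Finset.mem_filter.2 ⟨hA, hx⟩⟩, hj, fun B hB => ?_⟩
  rw [Finset.mem_filter, and_iff_right hB]

theorem mem_of_mem_cell {t j : Finset (FiniteMeasureSet μ)} {A : FiniteMeasureSet μ} (hA : A ∈ t)
    {x y : α} (hx : x ∈ cell t j) (hy : y ∈ cell t j) (hxA : x ∈ A.1) : y ∈ A.1 :=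
  (hy.2.2 A hA).1 ((hx.2.2 A hA).2 hxA)

theorem sum_indicator_cell_le_one (t : Finset (FiniteMeasureSet μ)) (x : α) :
    ∑ j ∈ t.powerset, (cell t j).indicator (1 : α → ℝ≥0∞) x ≤ 1 := by
  by_cases h : ∃ j ∈ t.powerset, x ∈ cell t j
  · obtain ⟨j, hj, hx⟩ := h
    rw [Finset.sum_eq_single_of_mem j hj fun j' _ hne =>
      Set.indicator_of_notMem (fun hx' => hne (eq_of_mem_cell hx' hx)) _]
    exact Set.indicator_le_self _ _ x
  · rw [Finset.sum_eq_zero fun j hj => Set.indicator_of_notMem (fun hx => h ⟨j, hj, hx⟩) _]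
    exact zero_le

end Cells

/-! ### From pointwise convergence to uniform convergence on compact sets, and the conclusion. -/

/-- A net of contractions of finite rank which converges pointwise to the identity on a set of dense
span yields the metric approximation property. -/
theorem metricApproximationProperty_of_tendsto {𝕜 E ι : Type*} [RCLike 𝕜] [NormedAddCommGroup E]
    [NormedSpace 𝕜 E] {l : Filter ι} [l.NeBot] {T : ι → E →L[𝕜] E}
    (hrank : ∀ t, FiniteDimensional 𝕜 (LinearMap.range (T t : E →ₗ[𝕜] E))) (hT : ∀ t, ‖T t‖ ≤ 1)
    {D : Set E} (hD : (Submodule.span 𝕜 D).topologicalClosure = ⊤)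
    (hlim : ∀ d ∈ D, Tendsto (fun t => T t d) l (𝓝 d)) : MetricApproximationProperty 𝕜 E := by
  have hspan : ∀ d ∈ Submodule.span 𝕜 D, Tendsto (fun t => T t d) l (𝓝 d) := fun d hd => by
    induction hd using Submodule.span_induction with
    | mem d hd => exact hlim d hd
    | zero => simpa only [map_zero] using tendsto_const_nhds
    | add x y _ _ hx hy => simpa only [map_add] using hx.add hy
    | smul c x _ hx => simpa only [map_smul] using hx.const_smul c
  have hTle : ∀ t x, ‖T t x‖ ≤ ‖x‖ := fun t x => by
    simpa only [one_mul] using (T t).le_of_opNorm_le (hT t) x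
  -- Contractivity makes the error of `T t` at `x` comparable with the one at `y`, uniformly in `t`.
  have happrox : ∀ (t : ι) (x y : E), ‖x - T t x‖ ≤ 2 * ‖x - y‖ + ‖y - T t y‖ := fun t x y => by
    have h : x - T t x = (x - y) - T t (x - y) + (y - T t y) := by
      rw [map_sub]
      abel
    rw [h]
    have h1 := norm_add_le ((x - y) - T t (x - y)) (y - T t y)
    have h2 := norm_sub_le (x - y) (T t (x - y))
    have h3 := hTle t (x - y)
    linarith
  have hall : ∀ (x : E) (ε : ℝ), 0 < ε → ∀ᶠ t in l, ‖x - T t x‖ < ε := fun x ε hε => by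
    have hx : x ∈ closure (Submodule.span 𝕜 D : Set E) := by
      rw [← Submodule.topologicalClosure_coe, hD]
      trivial
    -- The tolerances add up as `2 * (ε / 4) + ε / 2 = ε`, here and for the compact set.
    obtain ⟨d, hd, hxd⟩ := Metric.mem_closure_iff.1 hx (ε / 4) (by positivity)
    rw [dist_eq_norm] at hxd
    filter_upwards [Metric.tendsto_nhds.1 (hspan d hd) (ε / 2) (by positivity)] with t ht
    rw [dist_comm, dist_eq_norm] at ht
    have := happrox t x d
    linarith
  intro K hK ε hε
  obtain ⟨N, -, hN, hcov⟩ := hK.finite_cover_balls (e := ε / 4) (by positivity)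
  -- One index serves all the finitely many centres of the cover.
  obtain ⟨t, ht⟩ := ((eventually_all_finite hN).2 fun x _ => hall x (ε / 2) (by positivity)).exists
  refine ⟨T t, hrank t, hT t, fun x hx => ?_⟩
  obtain ⟨y, hy, hxy⟩ := Set.mem_iUnion₂.1 (hcov hx)
  rw [Metric.mem_ball, dist_eq_norm] at hxy
  have h1 := happrox t x y
  have h2 := ht y hy
  linarith

end MixedNorm

end

theorem theorem2p3 {𝕜 : Type*} [RCLike 𝕜] {n : ℕ} {Ω : Fin (n + 1) → Type*}
    [∀ i, MeasurableSpace (Ω i)] (μ : ∀ i, Measure (Ω i)) [∀ i, SigmaFinite (μ i)]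
    (p : Fin (n + 1) → ℝ) [Fact (∀ i, 1 ≤ p i)] (w : MixedNorm.Weight μ)
    (w' : ∀ i, Ω i → ℝ) (hw'_pos : ∀ i x, 0 < w' i x) (hw'_meas : ∀ i, AEMeasurable (w' i) (μ i))
    (hw : ∀ x : ∀ i, Ω i, w.toFun x ≤ ∏ i, w' i (x i)) :
    MixedNorm.MetricApproximationProperty 𝕜 (MixedNorm.Space 𝕜 μ p w) := by
  -- The net is indexed by tuples of finite families, ordered by inclusion; the labels of the cells
  -- are the subfamilies.
  choose T hrank hnorm hT using fun t : ∀ i, Finset (MixedNorm.FiniteMeasureSet (μ i)) =>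
    MixedNorm.exists_averaging (p := p) 𝕜 w (fun i => (t i).powerset)
      (fun i => MixedNorm.measurableSet_cell (t i)) (fun i => MixedNorm.measure_cell_lt_top (t i))
      (fun i => MixedNorm.sum_indicator_cell_le_one (t i))
  refine MixedNorm.metricApproximationProperty_of_tendsto (l := Filter.atTop) hrank hnorm
    MixedNorm.topologicalClosure_span_boxes ?_
  rintro f ⟨s, hs, hμ, hf⟩
  -- On a box the net is eventually constant: it fixes `f` once each `t i` contains the side `s i`.
  refine tendsto_const_nhds.congr' ?_
  filter_upwards [Filter.eventually_ge_atTop fun i => {⟨s i, hs i, hμ i⟩}] with t ht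
  have hmem : ∀ i, (⟨s i, hs i, hμ i⟩ : MixedNorm.FiniteMeasureSet (μ i)) ∈ t i := fun i =>
    Finset.singleton_subset_iff.1 (ht i)
  refine (MixedNorm.ext_unweight ((hT t f).trans (Filter.EventuallyEq.trans ?_ hf.symm))).symm
  refine Filter.EventuallyEq.trans (Filter.Eventually.of_forall fun x => ?_)
    (MixedNorm.sum_setIntegral_indicator_ae_eq 𝕜 (fun i => (t i).powerset)
      (fun i => MixedNorm.measurableSet_cell (t i)) (fun i => MixedNorm.measure_cell_lt_top (t i))
      (fun i x j j' => MixedNorm.eq_of_mem_cell) (s := s)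
      (fun i x hx => MixedNorm.exists_mem_cell (hmem i) hx)
      (fun i j x hx y hy => MixedNorm.mem_of_mem_cell (hmem i) hx hy))
  refine Finset.sum_congr rfl fun c _ => ?_
  rw [integral_congr_ae (ae_restrict_of_ae hf)]
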